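/- Let $K$ be a field of characteristic $\neq 2,3$ and let $\gamma\in K$ with $\gamma\neq 0,\pm1,\pm\frac12$. All algebras are nonassociative (not necessarily associative) and need not have a unit. For an element $x$ of a commutative $K$-algebra $A$ let $L_x\colon A\to A$, $L_x(a)=xa$, and $x^3=x(xx)$. An algebra is nilpotent if for some $m\ge 1$ every product of $m$ of its elements, however bracketed, is zero; the least such $m$ is its index of nilpotency. An algebra is locally nilpotent if each of its finitely generated subalgebras is nilpotent. (a) Every commutative $K$-algebra satisfying the identity $L_x^3+\gamma L_{x^3}=0$ is locally nilpotent. (b) More precisely, let $k\ge 1$. The free commutative $K$-algebra on $k$ generators satisfying the identity $x^3=0$ is nilpotent; let $n$ be its index of nilpotency. Let $\dim[n,k]$ be the dimension of the subspace of the free commutative $K$-algebra on $k$ generators that is spanned by the monomials of degree less than $n$. Then every commutative $K$-algebra that is generated by $k$ elements and satisfies $L_x^3+\gamma L_{x^3}=0$ is nilpotent of index at most $$2^{\,4n\dim[n,k]+2(n-2)}.$$ -/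

import Mathlib

universe u v

/-! ### Nilpotency of nonassociative algebras -/

/-- `ProductsVanish A n`: every product of `n` elements of `A`, with any arrangement of the
brackets, is zero. A bracketed product of elements of `A` is an element `w` of the free magma
on `A`, the number of its factors is `w.length`, and its value is `FreeMagma.lift id w`. -/
def ProductsVanish (A : Type v) [NonUnitalNonAssocRing A] (n : ℕ) : Prop :=
  ∀ w : FreeMagma A, w.length = n → FreeMagma.lift (id : A → A) w = 0

/-- `n` is the index of nilpotency of `A`: the least positive integer such that every product
of `n` elements of `A`, however bracketed, is zero. -/
def HasNilpotencyIndex (A : Type v) [NonUnitalNonAssocRing A] (n : ℕ) : Prop :=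
  IsLeast {m : ℕ | 0 < m ∧ ProductsVanish A m} n

/-- `A` is nilpotent: for some `n ≥ 1` all products of `n` elements vanish. -/
def IsNilpotentAlgebra (A : Type v) [NonUnitalNonAssocRing A] : Prop :=
  ∃ n : ℕ, 0 < n ∧ ProductsVanish A n

section

variable (K : Type u) [Field K] (A : Type v) [NonUnitalNonAssocCommRing A] [Module K A]
  [IsScalarTower K A A] [SMulCommClass K A A]

/-- `A` is locally nilpotent: every finitely generated subalgebra of `A` is nilpotent. -/
def IsLocallyNilpotentAlgebra : Prop :=
  ∀ s : Finset A, IsNilpotentAlgebra (NonUnitalAlgebra.adjoin K (s : Set A))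

/-- The algebra `A` is generated by `k` elements (not necessarily distinct). -/
def IsGeneratedBy (k : ℕ) : Prop :=
  ∃ g : Fin k → A, NonUnitalAlgebra.adjoin K (Set.range g) = ⊤

/-- The identity `L_x ^ 3 + γ L_{x ^ 3} = 0`, where `L_x` is the multiplication by `x` and
`x ^ 3 = x (x x)`. -/
def SatisfiesCubicIdentity (γ : K) : Prop :=
  ∀ x : A, LinearMap.mulLeft K x ∘ₗ LinearMap.mulLeft K x ∘ₗ LinearMap.mulLeft K x
    + γ • LinearMap.mulLeft K (x * (x * x)) = 0

end

/-! ### The free commutative algebra -/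

/-- The congruence on the free magma generated by `a b ~ b a`. -/
def commCon (X : Type u) : Con (FreeMagma X) :=
  conGen fun p q => ∃ a b : FreeMagma X, p = a * b ∧ q = b * a

/-- The commutative nonassociative monomials in the letters `X`. -/
abbrev CommMonomial (X : Type u) : Type u := (commCon X).Quotient

theorem commMonomial_mul_comm {X : Type u} (p q : CommMonomial X) : p * q = q * p := by
  induction p, q using Con.induction_on₂ with
  | H a b =>
    exact (Con.eq (commCon X)).2 (ConGen.Rel.of _ _ ⟨a, b, rfl, rfl⟩)

theorem length_eq_of_commCon {X : Type u} (a b : FreeMagma X) (h : commCon X a b) :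
    a.length = b.length := by
  change ConGen.Rel (fun p q => ∃ a b : FreeMagma X, p = a * b ∧ q = b * a) a b at h
  induction h with
  | of p q hpq =>
    obtain ⟨a, b, rfl, rfl⟩ := hpq
    exact Nat.add_comm _ _
  | refl => rfl
  | symm h ih => exact ih.symm
  | trans h1 h2 ih1 ih2 => exact ih1.trans ih2
  | mul h1 h2 ih1 ih2 => exact congrArg₂ (· + ·) ih1 ih2

/-- The degree of a commutative monomial: the number of its letters, with multiplicity. -/
def CommMonomial.degree {X : Type u} (p : CommMonomial X) : ℕ :=
  Con.liftOn p FreeMagma.length length_eq_of_commCon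

/-- The free commutative (nonassociative, nonunital) algebra over `K` on the set `X`: the vector
space with basis the commutative monomials, with the bilinear extension of their product. -/
abbrev FreeCommAlg (K : Type u) [Field K] (X : Type v) : Type (max u v) :=
  MonoidAlgebra K (CommMonomial X)

theorem freeCommAlg_mul_comm {K : Type u} [Field K] {X : Type v} (a b : FreeCommAlg K X) :
    a * b = b * a := by
  induction a using MonoidAlgebra.induction_linear with
  | zero => simp
  | add f g hf hg => rw [add_mul, mul_add, hf, hg]
  | single m r =>
    induction b using MonoidAlgebra.induction_linear with
    | zero => simp
    | add f g hf hg => rw [add_mul, mul_add, hf, hg]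
    | single n s =>
      rw [MonoidAlgebra.single_mul_single, MonoidAlgebra.single_mul_single,
        commMonomial_mul_comm m n, mul_comm r s]

/-- `dimBelow K n k`: the dimension of the subspace of the free commutative algebra on `k`
generators that is spanned by the monomials of degree less than `n`. -/
noncomputable def dimBelow (K : Type u) [Field K] (n k : ℕ) : ℕ :=
  Module.finrank K (Submodule.span K
    {f : FreeCommAlg K (Fin k) |
      ∃ p : CommMonomial (Fin k), p.degree < n ∧ f = MonoidAlgebra.single p 1})

/-! ### The free commutative algebra satisfying `x ^ 3 = 0` -/

/-- The ideal of the free commutative algebra generated by all cubes `a (a a)`: the smallest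
subspace that contains the cubes and is closed under multiplication by arbitrary elements. -/
noncomputable def cubeIdeal (K : Type u) [Field K] (X : Type v) :
    Submodule K (FreeCommAlg K X) :=
  sInf {N | (∀ a : FreeCommAlg K X, a * (a * a) ∈ N) ∧
    ∀ a : FreeCommAlg K X, ∀ b ∈ N, a * b ∈ N}

theorem mul_mem_cubeIdeal {K : Type u} [Field K] {X : Type v} (a : FreeCommAlg K X)
    {b : FreeCommAlg K X} (hb : b ∈ cubeIdeal K X) : a * b ∈ cubeIdeal K X := by
  rw [cubeIdeal, Submodule.mem_sInf] at hb ⊢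
  exact fun N hN => hN.2 a b (hb N hN)

/-- The free commutative algebra over `K` on the set `X` satisfying the identity `x ^ 3 = 0`. -/
abbrev FreeCubeZeroAlg (K : Type u) [Field K] (X : Type v) : Type (max u v) :=
  FreeCommAlg K X ⧸ cubeIdeal K X

/-- The product on the quotient by the ideal of cubes, induced by the product of
representatives. -/
noncomputable instance FreeCubeZeroAlg.instMul (K : Type u) [Field K] (X : Type v) :
    Mul (FreeCubeZeroAlg K X) where
  mul := Quotient.map₂ (· * ·) (by
    intro a a' ha b b' hb
    have ha' : a - a' ∈ cubeIdeal K X := (Submodule.quotientRel_def _).1 ha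
    have hb' : b - b' ∈ cubeIdeal K X := (Submodule.quotientRel_def _).1 hb
    refine (Submodule.quotientRel_def _).2 ?_
    have h : a * b - a' * b' = b * (a - a') + a' * (b - b') := by
      rw [mul_sub, mul_sub, freeCommAlg_mul_comm b a, freeCommAlg_mul_comm b a']
      abel
    change a * b - a' * b' ∈ cubeIdeal K X
    rw [h]
    exact add_mem (mul_mem_cubeIdeal _ ha') (mul_mem_cubeIdeal _ hb'))

noncomputable instance FreeCubeZeroAlg.instRing (K : Type u) [Field K] (X : Type v) :
    NonUnitalNonAssocCommRing (FreeCubeZeroAlg K X) where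
  __ := (inferInstance : AddCommGroup (FreeCommAlg K X ⧸ cubeIdeal K X))
  __ := FreeCubeZeroAlg.instMul K X
  left_distrib := by
    rintro ⟨a⟩ ⟨b⟩ ⟨c⟩
    exact congrArg (Submodule.Quotient.mk (p := cubeIdeal K X)) (mul_add a b c)
  right_distrib := by
    rintro ⟨a⟩ ⟨b⟩ ⟨c⟩
    exact congrArg (Submodule.Quotient.mk (p := cubeIdeal K X)) (add_mul a b c)
  zero_mul := by
    rintro ⟨a⟩
    exact congrArg (Submodule.Quotient.mk (p := cubeIdeal K X)) (zero_mul a)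
  mul_zero := by
    rintro ⟨a⟩
    exact congrArg (Submodule.Quotient.mk (p := cubeIdeal K X)) (mul_zero a)
  mul_comm := by
    rintro ⟨a⟩ ⟨b⟩
    exact congrArg (Submodule.Quotient.mk (p := cubeIdeal K X)) (freeCommAlg_mul_comm a b)

/-! Write L_a for multiplication by a, {a,b,c} for `cubeForm a b c` (so {x,x,x} = 3x³) and Q_{a,b} =
L_{ab} + L_a L_b + L_b L_a for the operator c ↦ {a,b,c}. Let I be the span of the cubes. The proof
shows that I is an ideal, that I·I = 0, and that sufficiently many multiplications annihilate I.
Modulo I the algebra satisfies x³ = 0, so every monomial of degree at least n in the generators lies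
in I.

Applying the identity to x itself gives (1+γ) x x³ = 0, hence x x³ = 0. Polarizing this and the
original identity yields a rule that moves a factor between the arguments of `cubeForm`
(`cubeForm_mul`, `cubeOp_mul`). It writes 4γ a x³ as a difference of two values of `cubeForm`, so I
is an ideal (`mul_mem_cubeSpan`). A long elimination gives L_x Q_{x,x} Q_{y,y} = 0; evaluated at y,
together with the polarized x x³ = 0, this says x³ y³ = 0 (`mul_eq_zero_of_mem_cubeSpan`).

Since I·I = 0, the operators L_{ {a,b,c} } vanish on I. With k = 2γ there remain two relations on I:
the symmetrization of L_a L_b L_c is zero, and, up to words with fewer letters and the same total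
degree, (ab+ba)c = -k c(ab+ba). For k ≠ 0, ±1 these force long words to be skew in their letters
(`eq_zero_of_anticommutator`). Monomials of degree at least n act as zero on I, so only d = dim[n,k]
letters matter. A word with at least d+3 letters therefore reduces to shorter ones, and a word with
at most d+2 letters and degree above (d+2)(n-1) contains a letter acting as zero. Now n-1
multiplications lead into I and (d+2)(n-1)+1 more give zero; in a commutative algebra a product of
2^m factors contains m nested multiplications.

That n exists is proved separately: if x³ = 0 holds identically, then L_{ab} = -(L_a L_b + L_b L_a),
and induction on the number of generators with a similar skew-symmetry argument shows that the
multiplications by the generators generate a nilpotent associative algebra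
(`exists_pow_span_eq_bot`). -/

set_option linter.unusedSectionVars false

open LinearMap

/-! ### Polarized identities for multiplications and the cube form -/

section CubicIdentity

variable {K : Type u} [Field K] {A : Type v} [NonUnitalNonAssocCommRing A] [Module K A]

/-- The full polarization of `3 x ^ 3`, where `x ^ 3 = x (x x)`. -/
def cubeForm (a b c : A) : A := a * (b * c) + b * (a * c) + c * (a * b)

variable [IsScalarTower K A A] [SMulCommClass K A A]

variable (K) in
/-- The operator `d ↦ cubeForm a b d`. -/
def cubeOp (a b : A) : Module.End K A :=
  mulLeft K (a * b) + mulLeft K a * mulLeft K b + mulLeft K b * mulLeft K a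

theorem cubeOp_apply (a b d : A) : cubeOp K a b d = cubeForm a b d := by
  simp only [cubeOp, cubeForm, LinearMap.add_apply, Module.End.mul_apply, mulLeft_apply]
  rw [mul_comm d (a * b)]; abel

theorem cubeOp_comm (a b : A) : cubeOp K a b = cubeOp K b a := by
  simp only [cubeOp, mul_comm a b]; abel

theorem mulLeft_add' (a b : A) : mulLeft K (a + b) = mulLeft K a + mulLeft K b := by
  ext d; simp [add_mul]

theorem mulLeft_smul' (t : K) (a : A) : mulLeft K (t • a) = t • mulLeft K a := by
  ext d; simp [smul_mul_assoc]

theorem mulLeft_zero' : mulLeft K (0 : A) = 0 := by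
  ext d; simp

theorem mulLeft_mul_eq (a b : A) :
    mulLeft K (a * b) = cubeOp K a b - mulLeft K a * mulLeft K b - mulLeft K b * mulLeft K a := by
  rw [cubeOp]; abel

theorem cubeOp_add (a b c : A) : cubeOp K (a + b) c = cubeOp K a c + cubeOp K b c := by
  simp only [cubeOp, add_mul, mul_add, mulLeft_add']; abel

theorem cubeOp_smul (t : K) (a c : A) : cubeOp K (t • a) c = t • cubeOp K a c := by
  simp only [cubeOp, smul_mul_assoc, mulLeft_smul', mul_smul_comm, smul_add]

theorem cubeOp_zero (c : A) : cubeOp K 0 c = 0 := by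
  simp only [cubeOp, zero_mul, mulLeft_zero', mul_zero, add_zero]

variable {γ : K}

theorem SatisfiesCubicIdentity.apply (h : SatisfiesCubicIdentity K A γ) (x v : A) :
    x * (x * (x * v)) + γ • ((x * (x * x)) * v) = 0 := by
  have := congrArg (fun f => f v) (h x)
  simpa using this

/-- Full linearization by inclusion-exclusion over the nonempty subsets of {a, b, c}. The
linearization of x(xx) is twice `cubeForm`, whence the factor 2γ. -/
theorem SatisfiesCubicIdentity.polarized (hA : SatisfiesCubicIdentity K A γ) (a b c v : A) :
    a * (b * (c * v)) + a * (c * (b * v)) + b * (a * (c * v)) + b * (c * (a * v))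
      + c * (a * (b * v)) + c * (b * (a * v)) + (2 * γ) • (cubeForm a b c * v) = 0 := by
  have h1 := hA.apply (a + b + c) v
  have h2 := hA.apply (a + b) v
  have h3 := hA.apply (a + c) v
  have h4 := hA.apply (b + c) v
  have h5 := hA.apply a v
  have h6 := hA.apply b v
  have h7 := hA.apply c v
  simp only [cubeForm, add_mul, mul_add, mul_comm b a, mul_comm c a, mul_comm c b] at *
  linear_combination (norm := module) h1 - h2 - h3 - h4 + h5 + h6 + h7

/-- When the operator identity is applied to x itself, commutativity makes both terms multiples of x
x³, with total coefficient 1 + γ. -/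
theorem SatisfiesCubicIdentity.mul_cube_self (hA : SatisfiesCubicIdentity K A γ) (hγ : γ ≠ -1)
    (x : A) : x * (x * (x * x)) = 0 := by
  have h := hA.apply x x
  rw [mul_comm (x * (x * x)) x, ← one_smul K (x * (x * (x * x))), smul_smul, ← add_smul] at h
  rcases smul_eq_zero.1 h with h | h
  · exact absurd (by linear_combination h) hγ
  · exact h

/-- Linearization of x x³ = 0 in four variables; inclusion-exclusion over their subsets produces
twice the sum. -/
theorem SatisfiesCubicIdentity.cyclic (hA : SatisfiesCubicIdentity K A γ) (h2 : (2 : K) ≠ 0)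
    (hγ : γ ≠ -1) (w x y z : A) :
    w * cubeForm x y z + x * cubeForm y z w + y * cubeForm x z w + z * cubeForm x y w = 0 := by
  have H := hA.mul_cube_self hγ
  have e : (2 : K) • (w * cubeForm x y z + x * cubeForm y z w + y * cubeForm x z w
      + z * cubeForm x y w) = 0 := by
    have h0 := H (w + x + y + z)
    have h1 := H (w + x + y)
    have h2' := H (w + x + z)
    have h3 := H (w + y + z)
    have h4 := H (x + y + z)
    have h5 := H (w + x)
    have h6 := H (w + y)
    have h7 := H (w + z)
    have h8 := H (x + y)
    have h9 := H (x + z)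
    have h10 := H (y + z)
    have h11 := H w
    have h12 := H x
    have h13 := H y
    have h14 := H z
    simp only [cubeForm, add_mul, mul_add, mul_comm x w, mul_comm y w, mul_comm z w, mul_comm y x,
      mul_comm z x, mul_comm z y] at *
    linear_combination (norm := module) h0 - h1 - h2' - h3 - h4 + h5 + h6 + h7 + h8 + h9 + h10 - h11
      - h12 - h13 - h14
  exact (smul_eq_zero.1 e).resolve_left h2

/-- This is `cyclic` read as an operator identity in one of its four arguments. -/
theorem SatisfiesCubicIdentity.sum_mulLeft_mul_cubeOp (hA : SatisfiesCubicIdentity K A γ)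
    (h2 : (2 : K) ≠ 0) (hγ : γ ≠ -1) (a b c : A) :
    mulLeft K a * cubeOp K b c + mulLeft K b * cubeOp K a c + mulLeft K c * cubeOp K a b
      = -mulLeft K (cubeForm a b c) := by
  ext v
  have h := hA.cyclic h2 hγ v a b c
  have e1 : cubeForm b c v = cubeOp K b c v := (cubeOp_apply b c v).symm
  have e2 : cubeForm a c v = cubeOp K a c v := (cubeOp_apply a c v).symm
  have e3 : cubeForm a b v = cubeOp K a b v := (cubeOp_apply a b v).symm
  rw [e1, e2, e3, mul_comm v] at h
  simp only [LinearMap.add_apply, LinearMap.neg_apply, Module.End.mul_apply, mulLeft_apply]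
  linear_combination (norm := abel) h

theorem SatisfiesCubicIdentity.sum_perm_mulLeft (hA : SatisfiesCubicIdentity K A γ)
    (a b c : A) :
    mulLeft K a * mulLeft K b * mulLeft K c + mulLeft K a * mulLeft K c * mulLeft K b
      + mulLeft K b * mulLeft K a * mulLeft K c + mulLeft K b * mulLeft K c * mulLeft K a
      + mulLeft K c * mulLeft K a * mulLeft K b + mulLeft K c * mulLeft K b * mulLeft K a
      = -((2 * γ) • mulLeft K (cubeForm a b c)) := by
  ext v
  have h := hA.polarized a b c v
  simp only [LinearMap.add_apply, LinearMap.neg_apply, LinearMap.smul_apply, Module.End.mul_apply,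
    mulLeft_apply]
  linear_combination (norm := abel) h

/-- How `cubeForm` behaves when a factor is moved from one argument to another. -/
theorem SatisfiesCubicIdentity.cubeForm_mul (hA : SatisfiesCubicIdentity K A γ)
    (h2 : (2 : K) ≠ 0) (hγ : γ ≠ -1) (a b y z : A) :
    cubeForm (a * b) y z = cubeForm a b (y * z)
      + (2 * γ) • (y * cubeForm a b z + z * cubeForm a b y) := by
  -- In h1 + h2 - h3 - h4 the pairs (a, b) and (y, z) play opposite roles: the fourfold products
  -- leave twice the difference of the two cube forms. `cyclic` then trades the terms a{b,y,z} +
  -- b{a,y,z} for those with y and z outside.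
  have h1 := hA.polarized y z a b
  have h2' := hA.polarized y z b a
  have h3 := hA.polarized a b y z
  have h4 := hA.polarized a b z y
  have h5 := hA.cyclic h2 hγ a b y z
  have e : (2 : K) • (cubeForm (a * b) y z - cubeForm a b (y * z)
      - (2 * γ) • (y * cubeForm a b z + z * cubeForm a b y)) = 0 := by
    simp only [cubeForm, mul_add, add_mul, mul_comm] at *
    linear_combination (norm := module) h1 + h2' - h3 - h4 - (2 * γ) • h5
  have := (smul_eq_zero.1 e).resolve_left h2
  linear_combination (norm := abel) this

/-- Reading `cubeForm_mul` as an operator in z leaves a term L_{ {a,b,y} }, which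
`sum_mulLeft_mul_cubeOp` eliminates. The result is a recursion: Q with a composite argument is
expressed by L and by Q with the smaller arguments. -/
theorem SatisfiesCubicIdentity.cubeOp_mul (hA : SatisfiesCubicIdentity K A γ)
    (h2 : (2 : K) ≠ 0) (hγ : γ ≠ -1) (a b y : A) :
    cubeOp K (a * b) y = cubeOp K a b * mulLeft K y
      - (2 * γ) • (mulLeft K a * cubeOp K b y + mulLeft K b * cubeOp K a y) := by
  ext v
  have h := hA.cubeForm_mul h2 hγ a b y v
  have h' := congrArg (fun f => f v) (hA.sum_mulLeft_mul_cubeOp h2 hγ a b y)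
  simp only [LinearMap.add_apply, LinearMap.neg_apply, Module.End.mul_apply, mulLeft_apply,
    LinearMap.sub_apply, LinearMap.smul_apply, cubeOp_apply] at h' ⊢
  rw [h, mul_comm v]
  linear_combination (norm := module) (2 * γ) • h'

/-- Eliminating L_{ {a,b,c} } between the two symmetric identities leaves a relation in which a, b,
c enter only through their own L and Q. -/
theorem SatisfiesCubicIdentity.sum_perm_mulLeft_eq (hA : SatisfiesCubicIdentity K A γ)
    (h2 : (2 : K) ≠ 0) (hγ : γ ≠ -1) (a b c : A) :
    mulLeft K a * mulLeft K b * mulLeft K c + mulLeft K a * mulLeft K c * mulLeft K b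
      + mulLeft K b * mulLeft K a * mulLeft K c + mulLeft K b * mulLeft K c * mulLeft K a
      + mulLeft K c * mulLeft K a * mulLeft K b + mulLeft K c * mulLeft K b * mulLeft K a
      = (2 * γ) • (mulLeft K a * cubeOp K b c + mulLeft K b * cubeOp K a c
        + mulLeft K c * cubeOp K a b) := by
  rw [hA.sum_perm_mulLeft, hA.sum_mulLeft_mul_cubeOp h2 hγ, smul_neg]

end CubicIdentity

/-! ### The identity behind the vanishing of products of cubes -/

section

variable {K : Type u} [Field K] {A : Type v} [NonUnitalNonAssocCommRing A] [Module K A]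
  [IsScalarTower K A A] [SMulCommClass K A A]

set_option linter.unusedSimpArgs false in
set_option maxHeartbeats 4000000 in
/-- The proof expands operators of composite elements into words in `a = L_x`, `b = L_y`,
`p = Q_xx`, `q = Q_xy` and `r = Q_yy`. In the names of these expansions `o` and `c` stand for
parentheses. The relations between words are instances of the symmetrized cubic identity
(`rel_sym`) and the two ways of expanding an operator (`rel_form`, `rel_op`); a combination of
them, with two cases according to whether `k ^ 2 - k - 1` vanishes, is the claim. -/
theorem SatisfiesCubicIdentity.mulLeft_mul_cubeOp_mul_cubeOp {γ : K}
    (hA : SatisfiesCubicIdentity K A γ) (h2 : (2 : K) ≠ 0) (h3 : (3 : K) ≠ 0) (hγ : γ ≠ -1)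
    (hγ0 : γ ≠ 0) (hγ1 : γ ≠ 1 / 2) (x y : A) :
    mulLeft K x * (cubeOp K x x * cubeOp K y y) = 0 := by
  have hsym := hA.sum_perm_mulLeft_eq h2 hγ
  have hopmul := hA.cubeOp_mul h2 hγ
  have hform (a b y z : A) : cubeForm (a * b) y z - (cubeForm a b (y * z)
      + (2 * γ) • (y * cubeForm a b z + z * cubeForm a b y)) = 0 :=
    sub_eq_zero.2 (hA.cubeForm_mul h2 hγ a b y z)
  have hk0 : 2 * γ ≠ 0 := mul_ne_zero h2 hγ0
  have hk1 : 2 * γ - 1 ≠ 0 := fun h => hγ1 (by field_simp; linear_combination h)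
  generalize 2 * γ = k at *
  -- From here on a, b, p, q, r are treated as noncommuting symbols, and each composite L or Q is
  -- expanded into words by `mulLeft_mul_eq` and `cubeOp_mul`.
  generalize hL_x : mulLeft K x = a
  generalize hL_y : mulLeft K y = b
  generalize hQ_xx : cubeOp K x x = p
  generalize hQ_xy : cubeOp K x y = q
  generalize hQ_yy : cubeOp K y y = r
  have hQ_yx : cubeOp K y x = q := by rw [cubeOp_comm, hQ_xy]
  have hQ_oyyc_x : cubeOp K (y * y) x = r * a - (2 * k : K) • (b * q) := by
    rw [hopmul, hQ_yy, hQ_yx, hL_x, hL_y]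
    try simp only [mul_add, add_mul, mul_sub, sub_mul, neg_mul, mul_neg, smul_mul_assoc,
        mul_smul_comm, mul_assoc, mul_zero, zero_mul]
    module
  have hL_oyyc : mulLeft K (y * y) = r - (2 : K) • (b * b) := by
    rw [mulLeft_mul_eq, hQ_yy, hL_y]
    try simp only [mul_add, add_mul, mul_sub, sub_mul, neg_mul, mul_neg, smul_mul_assoc,
        mul_smul_comm, mul_assoc, mul_zero, zero_mul]
    module
  have hQ_ooyycxc_x : cubeOp K ((y * y) * x) x = -((k : K) • (r * p)) + r * (a * a) - (k : K)
      • (a * (r * a)) + (2 * k ^ 2 : K) • (a * (b * q)) - (2 * k : K) • (b * (q * a))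
      + (2 * k : K) • (b * (b * p)) := by
    rw [hopmul, hQ_oyyc_x, hQ_xx, hL_x, hL_oyyc]
    try simp only [mul_add, add_mul, mul_sub, sub_mul, neg_mul, mul_neg, smul_mul_assoc,
        mul_smul_comm, mul_assoc, mul_zero, zero_mul]
    module
  have hL_ooyycxc : mulLeft K ((y * y) * x) = -(a * r) - (2 * k : K) • (b * q) + (2 : K)
      • (a * (b * b)) + (2 : K) • (b * (b * a)) := by
    rw [mulLeft_mul_eq, hQ_oyyc_x, hL_oyyc, hL_x]
    try simp only [mul_add, add_mul, mul_sub, sub_mul, neg_mul, mul_neg, smul_mul_assoc,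
        mul_smul_comm, mul_assoc, mul_zero, zero_mul]
    module
  have hQ_oooyycxcxc_x : cubeOp K (((y * y) * x) * x) x = -((k : K) • (r * (p * a))) + (k ^ 2
      + k : K) • (a * (r * p)) + (2 * k ^ 2 : K) • (b * (q * p)) + r * (a * (a * a))
      - (2 * k : K) • (a * (r * (a * a))) + (k ^ 2 : K) • (a * (a * (r * a))) - (2 * k ^ 3 : K)
      • (a * (a * (b * q))) + (4 * k ^ 2 : K) • (a * (b * (q * a))) + (-2 * k ^ 2 - 2 * k : K)
      • (a * (b * (b * p))) - (2 * k : K) • (b * (q * (a * a))) + (2 * k : K)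
      • (b * (b * (p * a))) - (2 * k : K) • (b * (b * (a * p))) := by
    rw [hopmul, hQ_ooyycxc_x, hQ_xx, hL_x, hL_ooyycxc]
    try simp only [mul_add, add_mul, mul_sub, sub_mul, neg_mul, mul_neg, smul_mul_assoc,
        mul_smul_comm, mul_assoc, mul_zero, zero_mul]
    module
  have hL_oooyycxcxc : mulLeft K (((y * y) * x) * x) = -((k : K) • (r * p)) + r * (a * a) + (-k
      + 1 : K) • (a * (r * a)) + a * (a * r) + (2 * k ^ 2 + 2 * k : K) • (a * (b * q))
      + (2 * k : K) • (b * (b * p)) - (2 : K) • (a * (a * (b * b))) - (4 : K)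
      • (a * (b * (b * a))) - (2 : K) • (b * (b * (a * a))) := by
    rw [mulLeft_mul_eq, hQ_ooyycxc_x, hL_ooyycxc, hL_x]
    try simp only [mul_add, add_mul, mul_sub, sub_mul, neg_mul, mul_neg, smul_mul_assoc,
        mul_smul_comm, mul_assoc, mul_zero, zero_mul]
    module
  have hL_ooooyycxcxcxc : mulLeft K ((((y * y) * x) * x) * x) = (k ^ 2 + 2 * k : K)
      • (a * (r * p)) + (2 * k ^ 2 : K) • (b * (q * p)) + (-k - 2 : K) • (a * (r * (a * a)))
      + (k ^ 2 + k - 2 : K) • (a * (a * (r * a))) - a * (a * (a * r)) + (-2 * k ^ 3 - 2 * k ^ 2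
      - 2 * k : K) • (a * (a * (b * q))) + (2 * k ^ 2 - 2 * k : K) • (a * (b * (q * a)))
      + (-2 * k ^ 2 - 4 * k : K) • (a * (b * (b * p))) - (2 * k : K) • (b * (q * (a * a)))
      - (2 * k : K) • (b * (b * (a * p))) + (2 : K) • (a * (a * (a * (b * b)))) + (6 : K)
      • (a * (a * (b * (b * a)))) + (6 : K) • (a * (b * (b * (a * a)))) + (2 : K)
      • (b * (b * (a * (a * a)))) := by
    rw [mulLeft_mul_eq, hQ_oooyycxcxc_x, hL_oooyycxcxc, hL_x]
    try simp only [mul_add, add_mul, mul_sub, sub_mul, neg_mul, mul_neg, smul_mul_assoc,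
        mul_smul_comm, mul_assoc, mul_zero, zero_mul]
    module
  have hQ_x_oyyc : cubeOp K x (y * y) = r * a - (2 * k : K) • (b * q) := by
    rw [cubeOp_comm, hQ_oyyc_x]
  have hQ_oxxc_oyyc : cubeOp K (x * x) (y * y) = p * r - (2 : K) • (p * (b * b)) - (2 * k : K)
      • (a * (r * a)) + (4 * k ^ 2 : K) • (a * (b * q)) := by
    rw [hopmul, hQ_xx, hQ_x_oyyc, hL_oyyc, hL_x]
    try simp only [mul_add, add_mul, mul_sub, sub_mul, neg_mul, mul_neg, smul_mul_assoc,
        mul_smul_comm, mul_assoc, mul_zero, zero_mul]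
    module
  have hQ_oxxc_x : cubeOp K (x * x) x = p * a - (2 * k : K) • (a * p) := by
    rw [hopmul, hQ_xx, hL_x]
    try simp only [mul_add, add_mul, mul_sub, sub_mul, neg_mul, mul_neg, smul_mul_assoc,
        mul_smul_comm, mul_assoc, mul_zero, zero_mul]
    module
  have hL_oxxc : mulLeft K (x * x) = p - (2 : K) • (a * a) := by
    rw [mulLeft_mul_eq, hQ_xx, hL_x]
    try simp only [mul_add, add_mul, mul_sub, sub_mul, neg_mul, mul_neg, smul_mul_assoc,
        mul_smul_comm, mul_assoc, mul_zero, zero_mul]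
    module
  have hQ_ooxxcoyycc_x : cubeOp K ((x * x) * (y * y)) x = (-k + 1 : K) • (p * (r * a))
      + (2 * k ^ 2 : K) • (p * (b * q)) - (k : K) • (r * (p * a)) + (2 * k ^ 2 : K)
      • (r * (a * p)) - (2 : K) • (p * (b * (b * a))) - (2 * k : K) • (a * (r * (a * a)))
      + (2 * k : K) • (a * (a * (r * a))) - (4 * k ^ 2 : K) • (a * (a * (b * q)))
      + (4 * k ^ 2 : K) • (a * (b * (q * a))) + (2 * k : K) • (b * (b * (p * a)))
      - (4 * k ^ 2 : K) • (b * (b * (a * p))) := by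
    rw [hopmul, hQ_oxxc_oyyc, hQ_oyyc_x, hQ_oxxc_x, hL_x, hL_oxxc, hL_oyyc]
    try simp only [mul_add, add_mul, mul_sub, sub_mul, neg_mul, mul_neg, smul_mul_assoc,
        mul_smul_comm, mul_assoc, mul_zero, zero_mul]
    module
  have hL_ooxxcoyycc : mulLeft K ((x * x) * (y * y)) = -(r * p) + (2 : K) • (r * (a * a))
      - (2 * k : K) • (a * (r * a)) + (2 : K) • (a * (a * r)) + (4 * k ^ 2 : K) • (a * (b * q))
      + (2 : K) • (b * (b * p)) - (4 : K) • (a * (a * (b * b))) - (4 : K)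
      • (b * (b * (a * a))) := by
    rw [mulLeft_mul_eq, hQ_oxxc_oyyc, hL_oxxc, hL_oyyc]
    try simp only [mul_add, add_mul, mul_sub, sub_mul, neg_mul, mul_neg, smul_mul_assoc,
        mul_smul_comm, mul_assoc, mul_zero, zero_mul]
    module
  have hL_oooxxcoyyccxc : mulLeft K (((x * x) * (y * y)) * x) = (-k + 1 : K) • (p * (r * a))
      + (2 * k ^ 2 : K) • (p * (b * q)) + (-k + 1 : K) • (r * (p * a)) + (2 * k ^ 2 : K)
      • (r * (a * p)) + a * (r * p) - (2 : K) • (p * (b * (b * a))) - (2 : K)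
      • (r * (a * (a * a))) - (2 : K) • (a * (r * (a * a))) + (4 * k - 2 : K)
      • (a * (a * (r * a))) - (2 : K) • (a * (a * (a * r))) - (8 * k ^ 2 : K)
      • (a * (a * (b * q))) - (2 : K) • (a * (b * (b * p))) + (2 * k - 2 : K)
      • (b * (b * (p * a))) - (4 * k ^ 2 : K) • (b * (b * (a * p))) + (4 : K)
      • (a * (a * (a * (b * b)))) + (4 : K) • (a * (a * (b * (b * a)))) + (4 : K)
      • (a * (b * (b * (a * a)))) + (4 : K) • (b * (b * (a * (a * a)))) := by
    rw [mulLeft_mul_eq, hQ_ooxxcoyycc_x, hL_ooxxcoyycc, hL_x]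
    try simp only [mul_add, add_mul, mul_sub, sub_mul, neg_mul, mul_neg, smul_mul_assoc,
        mul_smul_comm, mul_assoc, mul_zero, zero_mul]
    module
  have hQ_ooxxcxc_oyyc : cubeOp K ((x * x) * x) (y * y) = -((k : K) • (p * (r * a)))
      + p * (a * r) + (2 * k ^ 2 : K) • (p * (b * q)) - (3 * k : K) • (a * (p * r)) - (2 : K)
      • (p * (a * (b * b))) + (6 * k : K) • (a * (p * (b * b))) + (2 * k ^ 2 + 2 * k : K)
      • (a * (a * (r * a))) + (-4 * k ^ 3 - 4 * k ^ 2 : K) • (a * (a * (b * q))) := by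
    rw [hopmul, hQ_oxxc_x, hQ_x_oyyc, hQ_oxxc_oyyc, hL_oyyc, hL_oxxc, hL_x]
    try simp only [mul_add, add_mul, mul_sub, sub_mul, neg_mul, mul_neg, smul_mul_assoc,
        mul_smul_comm, mul_assoc, mul_zero, zero_mul]
    module
  have hL_ooxxcxc : mulLeft K ((x * x) * x) = (-2 * k - 1 : K) • (a * p) + (4 : K)
      • (a * (a * a)) := by
    rw [mulLeft_mul_eq, hQ_oxxc_x, hL_oxxc, hL_x]
    try simp only [mul_add, add_mul, mul_sub, sub_mul, neg_mul, mul_neg, smul_mul_assoc,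
        mul_smul_comm, mul_assoc, mul_zero, zero_mul]
    module
  have hL_oooxxcxcoyycc : mulLeft K (((x * x) * x) * (y * y)) = -((k : K) • (p * (r * a)))
      + p * (a * r) + (2 * k ^ 2 : K) • (p * (b * q)) + (2 * k + 1 : K) • (r * (a * p)) + (-k
      + 1 : K) • (a * (p * r)) - (2 : K) • (p * (a * (b * b))) - (4 : K) • (r * (a * (a * a)))
      + (2 * k - 2 : K) • (a * (p * (b * b))) + (2 * k ^ 2 + 2 * k : K) • (a * (a * (r * a)))
      - (4 : K) • (a * (a * (a * r))) + (-4 * k ^ 3 - 4 * k ^ 2 : K) • (a * (a * (b * q)))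
      + (-4 * k - 2 : K) • (b * (b * (a * p))) + (8 : K) • (a * (a * (a * (b * b)))) + (8 : K)
      • (b * (b * (a * (a * a)))) := by
    rw [mulLeft_mul_eq, hQ_ooxxcxc_oyyc, hL_ooxxcxc, hL_oyyc]
    try simp only [mul_add, add_mul, mul_sub, sub_mul, neg_mul, mul_neg, smul_mul_assoc,
        mul_smul_comm, mul_assoc, mul_zero, zero_mul]
    module
  have rel_form_x_x_oyyc_x : (4 * k ^ 2 - 3 * k + 1 : K) • (p * (r * a)) + (-3 * k + 1 : K)
      • (p * (a * r)) + (-8 * k ^ 3 + 4 * k ^ 2 : K) • (p * (b * q)) + (k ^ 2 - 2 * k + 1 : K)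
      • (r * (p * a)) + (-2 * k ^ 3 - 4 * k ^ 2 - k + 1 : K) • (r * (a * p)) + (3 * k ^ 2
      - 4 * k + 1 : K) • (a * (p * r)) + (-2 * k ^ 3 - 6 * k ^ 2 - 5 * k + 1 : K)
      • (a * (r * p)) + (-4 * k ^ 3 - 4 * k ^ 2 : K) • (b * (q * p)) + (6 * k - 2 : K)
      • (p * (a * (b * b))) + (2 * k - 2 : K) • (p * (b * (b * a))) + (14 * k - 6 : K)
      • (r * (a * (a * a))) + (-6 * k ^ 2 + 8 * k - 2 : K) • (a * (p * (b * b))) + (2 * k ^ 2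
      + 8 * k + 2 : K) • (a * (r * (a * a))) + (-8 * k ^ 3 - 12 * k ^ 2 + 10 * k + 2 : K)
      • (a * (a * (r * a))) + (16 * k - 4 : K) • (a * (a * (a * r))) + (16 * k ^ 4 + 24 * k ^ 3
      - 4 * k ^ 2 + 4 * k : K) • (a * (a * (b * q))) + (-4 * k ^ 3 + 4 * k : K)
      • (a * (b * (q * a))) + (4 * k ^ 3 + 12 * k ^ 2 + 10 * k - 2 : K) • (a * (b * (b * p)))
      + (4 * k ^ 2 + 4 * k : K) • (b * (q * (a * a))) + (-2 * k ^ 2 + 4 * k - 2 : K)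
      • (b * (b * (p * a))) + (4 * k ^ 3 + 12 * k ^ 2 + 6 * k - 2 : K) • (b * (b * (a * p)))
      + (-32 * k + 8 : K) • (a * (a * (a * (b * b)))) + (-16 * k - 8 : K)
      • (a * (a * (b * (b * a)))) + (-16 * k - 8 : K) • (a * (b * (b * (a * a)))) + (-32 * k
      + 8 : K) • (b * (b * (a * (a * a)))) = 0 := by
    -- An instance of `cubeForm_mul` is a linear relation between monomials of A. Taking left
    -- multiplications of its terms and expanding them gives a relation between words.
    have e : (-2 * k - 2 : K) • ((((y * y) * x) * x) * x) + (-k + 1 : K)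
        • (((x * x) * (y * y)) * x) + (-3 * k + 1 : K) • (((x * x) * x) * (y * y)) = 0 := by
      linear_combination (norm := (simp only [cubeForm, mul_add, add_mul, mul_comm]; module))
          hform x x (y * y) x
    have h := congrArg (mulLeft K) e
    simp only [mulLeft_add', mulLeft_smul', mulLeft_zero', hL_ooooyycxcxcxc, hL_oooxxcoyyccxc,
        hL_oooxxcxcoyycc] at h
    linear_combination (norm := ((try simp only [mul_add, add_mul, mul_sub, sub_mul, neg_mul,
        mul_neg, smul_mul_assoc, mul_smul_comm, mul_assoc, mul_zero, zero_mul]); module)) h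
  have rel_sym_x_x_x : -((3 * k : K) • (a * p)) + (6 : K) • (a * (a * a)) = 0 := by
    have h := hsym x x x
    simp only [hL_x, hQ_xx] at h
    linear_combination (norm := ((try simp only [mul_add, add_mul, mul_sub, sub_mul, neg_mul,
        mul_neg, smul_mul_assoc, mul_smul_comm, mul_assoc, mul_zero, zero_mul]); module)) h
  have hQ_oxxc_y : cubeOp K (x * x) y = p * b - (2 * k : K) • (a * q) := by
    rw [hopmul, hQ_xx, hQ_xy, hL_y, hL_x]
    try simp only [mul_add, add_mul, mul_sub, sub_mul, neg_mul, mul_neg, smul_mul_assoc,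
        mul_smul_comm, mul_assoc, mul_zero, zero_mul]
    module
  have hQ_ooxxcxc_y : cubeOp K ((x * x) * x) y = -((k : K) • (p * q)) + p * (a * b)
      - (3 * k : K) • (a * (p * b)) + (2 * k ^ 2 + 2 * k : K) • (a * (a * q)) := by
    rw [hopmul, hQ_oxxc_x, hQ_xy, hQ_oxxc_y, hL_y, hL_oxxc, hL_x]
    try simp only [mul_add, add_mul, mul_sub, sub_mul, neg_mul, mul_neg, smul_mul_assoc,
        mul_smul_comm, mul_assoc, mul_zero, zero_mul]
    module
  have hQ_y_ooxxcxc : cubeOp K y ((x * x) * x) = -((k : K) • (p * q)) + p * (a * b)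
      - (3 * k : K) • (a * (p * b)) + (2 * k ^ 2 + 2 * k : K) • (a * (a * q)) := by
    rw [cubeOp_comm, hQ_ooxxcxc_y]
  have rel_sym_y_y_ooxxcxc : (2 * k ^ 2 + k : K) • (a * (p * r)) + (2 * k ^ 2 : K)
      • (b * (p * q)) + (-4 * k - 2 : K) • (a * (p * (b * b))) - (4 * k : K)
      • (a * (a * (a * r))) - (2 * k : K) • (b * (p * (a * b))) + (6 * k ^ 2 - 4 * k - 2 : K)
      • (b * (a * (p * b))) + (-4 * k ^ 3 - 4 * k ^ 2 : K) • (b * (a * (a * q))) + (-4 * k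
      - 2 : K) • (b * (b * (a * p))) + (8 : K) • (a * (a * (a * (b * b)))) + (8 : K)
      • (b * (a * (a * (a * b)))) + (8 : K) • (b * (b * (a * (a * a)))) = 0 := by
    have h := hsym y y ((x * x) * x)
    simp only [hL_y, hL_ooxxcxc, hQ_y_ooxxcxc, hQ_yy] at h
    linear_combination (norm := ((try simp only [mul_add, add_mul, mul_sub, sub_mul, neg_mul,
        mul_neg, smul_mul_assoc, mul_smul_comm, mul_assoc, mul_zero, zero_mul]); module)) h
  have rel_sym_y_x_x : -((2 * k : K) • (a * q)) - (k : K) • (b * p) + (2 : K) • (a * (a * b))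
      + (2 : K) • (a * (b * a)) + (2 : K) • (b * (a * a)) = 0 := by
    have h := hsym y x x
    simp only [hL_y, hL_x, hQ_xx, hQ_yx] at h
    linear_combination (norm := ((try simp only [mul_add, add_mul, mul_sub, sub_mul, neg_mul,
        mul_neg, smul_mul_assoc, mul_smul_comm, mul_assoc, mul_zero, zero_mul]); module)) h
  have rel_form_oyyc_x_x_x : (2 * k ^ 2 - 1 : K) • (p * (r * a)) - p * (a * r) + (-4 * k ^ 3
      - 4 * k ^ 2 : K) • (p * (b * q)) + (2 * k ^ 2 - k - 1 : K) • (r * (p * a)) + (-4 * k ^ 3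
      - 2 * k ^ 2 - 2 * k - 1 : K) • (r * (a * p)) + (k - 1 : K) • (a * (p * r)) + (-4 * k ^ 3
      - 6 * k ^ 2 + 2 * k - 1 : K) • (a * (r * p)) + (-8 * k ^ 3 + 4 * k ^ 2 : K)
      • (b * (q * p)) + (2 : K) • (p * (a * (b * b))) + (4 * k + 2 : K) • (p * (b * (b * a)))
      + (4 * k + 6 : K) • (r * (a * (a * a))) + (-2 * k + 2 : K) • (a * (p * (b * b)))
      + (4 * k ^ 2 + 10 * k - 2 : K) • (a * (r * (a * a))) + (-4 * k ^ 3 - 12 * k ^ 2 + 8 * k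
      - 2 : K) • (a * (a * (r * a))) + (8 * k + 4 : K) • (a * (a * (a * r))) + (8 * k ^ 4
      + 24 * k ^ 3 + 16 * k ^ 2 - 4 * k : K) • (a * (a * (b * q))) + (-8 * k ^ 3 + 12 * k ^ 2
      - 4 * k : K) • (a * (b * (q * a))) + (8 * k ^ 3 + 12 * k ^ 2 - 4 * k + 2 : K)
      • (a * (b * (b * p))) + (8 * k ^ 2 - 4 * k : K) • (b * (q * (a * a))) + (-4 * k ^ 2
      + 2 * k + 2 : K) • (b * (b * (p * a))) + (8 * k ^ 3 + 12 * k ^ 2 + 2 : K)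
      • (b * (b * (a * p))) + (-16 * k - 8 : K) • (a * (a * (a * (b * b)))) + (-32 * k + 8 : K)
      • (a * (a * (b * (b * a)))) + (-32 * k + 8 : K) • (a * (b * (b * (a * a)))) + (-16 * k
      - 8 : K) • (b * (b * (a * (a * a)))) = 0 := by
    have e : (-4 * k + 2 : K) • ((((y * y) * x) * x) * x) + (-2 * k - 1 : K)
        • (((x * x) * (y * y)) * x) + (-1 : K) • (((x * x) * x) * (y * y)) = 0 := by
      linear_combination (norm := (simp only [cubeForm, mul_add, add_mul, mul_comm]; module))
          hform (y * y) x x x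
    have h := congrArg (mulLeft K) e
    simp only [mulLeft_add', mulLeft_smul', mulLeft_zero', hL_ooooyycxcxcxc, hL_oooxxcoyyccxc,
        hL_oooxxcxcoyycc] at h
    linear_combination (norm := ((try simp only [mul_add, add_mul, mul_sub, sub_mul, neg_mul,
        mul_neg, smul_mul_assoc, mul_smul_comm, mul_assoc, mul_zero, zero_mul]); module)) h
  have hQ_oxyc_y : cubeOp K (x * y) y = q * b - (k : K) • (a * r) - (k : K) • (b * q) := by
    rw [hopmul, hQ_xy, hQ_yy, hL_y, hL_x]
    try simp only [mul_add, add_mul, mul_sub, sub_mul, neg_mul, mul_neg, smul_mul_assoc,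
        mul_smul_comm, mul_assoc, mul_zero, zero_mul]
    module
  have hL_oxyc : mulLeft K (x * y) = q - a * b - b * a := by
    rw [mulLeft_mul_eq, hQ_xy, hL_x, hL_y]
  have hL_ooxycyc : mulLeft K ((x * y) * y) = -((k : K) • (a * r)) + (-k - 1 : K) • (b * q)
      + a * (b * b) + (2 : K) • (b * (a * b)) + b * (b * a) := by
    rw [mulLeft_mul_eq, hQ_oxyc_y, hL_oxyc, hL_y]
    try simp only [mul_add, add_mul, mul_sub, sub_mul, neg_mul, mul_neg, smul_mul_assoc,
        mul_smul_comm, mul_assoc, mul_zero, zero_mul]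
    module
  have hQ_oxyc_x : cubeOp K (x * y) x = q * a - (k : K) • (a * q) - (k : K) • (b * p) := by
    rw [hopmul, hQ_xy, hQ_yx, hQ_xx, hL_x, hL_y]
    try simp only [mul_add, add_mul, mul_sub, sub_mul, neg_mul, mul_neg, smul_mul_assoc,
        mul_smul_comm, mul_assoc, mul_zero, zero_mul]
    module
  have hQ_ooxycyc_x : cubeOp K ((x * y) * y) x = -((k : K) • (q * q)) + q * (b * a) - (k : K)
      • (a * (r * a)) + (k : K) • (a * (b * q)) - (2 * k : K) • (b * (q * a)) + (k ^ 2 + k : K)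
      • (b * (a * q)) + (k ^ 2 : K) • (b * (b * p)) := by
    rw [hopmul, hQ_oxyc_y, hQ_yx, hQ_oxyc_x, hL_x, hL_oxyc, hL_y]
    try simp only [mul_add, add_mul, mul_sub, sub_mul, neg_mul, mul_neg, smul_mul_assoc,
        mul_smul_comm, mul_assoc, mul_zero, zero_mul]
    module
  have hQ_x_ooxycyc : cubeOp K x ((x * y) * y) = -((k : K) • (q * q)) + q * (b * a) - (k : K)
      • (a * (r * a)) + (k : K) • (a * (b * q)) - (2 * k : K) • (b * (q * a)) + (k ^ 2 + k : K)
      • (b * (a * q)) + (k ^ 2 : K) • (b * (b * p)) := by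
    rw [cubeOp_comm, hQ_ooxycyc_x]
  have rel_sym_x_x_ooxycyc : (2 * k ^ 2 : K) • (a * (q * q)) + (k ^ 2 : K) • (a * (r * p))
      + (k ^ 2 + k : K) • (b * (q * p)) - (2 * k : K) • (a * (q * (b * a))) - (2 * k : K)
      • (a * (r * (a * a))) + (2 * k ^ 2 - 2 * k : K) • (a * (a * (r * a))) - (2 * k : K)
      • (a * (a * (a * r))) + (-2 * k ^ 2 - 2 * k - 2 : K) • (a * (a * (b * q))) + (4 * k ^ 2
      - 2 * k - 2 : K) • (a * (b * (q * a))) + (-2 * k ^ 3 - 2 * k ^ 2 : K)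
      • (a * (b * (a * q))) + (-2 * k ^ 3 - k : K) • (a * (b * (b * p))) + (-2 * k - 2 : K)
      • (b * (q * (a * a))) - (2 * k : K) • (b * (a * (b * p))) - (k : K) • (b * (b * (a * p)))
      + (2 : K) • (a * (a * (a * (b * b)))) + (4 : K) • (a * (a * (b * (a * b)))) + (4 : K)
      • (a * (a * (b * (b * a)))) + (4 : K) • (a * (b * (a * (b * a)))) + (4 : K)
      • (a * (b * (b * (a * a)))) + (4 : K) • (b * (a * (b * (a * a)))) + (2 : K)
      • (b * (b * (a * (a * a)))) = 0 := by
    have h := hsym x x ((x * y) * y)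
    simp only [hL_x, hL_ooxycyc, hQ_x_ooxycyc, hQ_xx] at h
    linear_combination (norm := ((try simp only [mul_add, add_mul, mul_sub, sub_mul, neg_mul,
        mul_neg, smul_mul_assoc, mul_smul_comm, mul_assoc, mul_zero, zero_mul]); module)) h
  have rel_sym_y_y_x : -((k : K) • (a * r)) - (2 * k : K) • (b * q) + (2 : K) • (a * (b * b))
      + (2 : K) • (b * (a * b)) + (2 : K) • (b * (b * a)) = 0 := by
    have h := hsym y y x
    simp only [hL_y, hL_x, hQ_yx, hQ_yy] at h
    linear_combination (norm := ((try simp only [mul_add, add_mul, mul_sub, sub_mul, neg_mul,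
        mul_neg, smul_mul_assoc, mul_smul_comm, mul_assoc, mul_zero, zero_mul]); module)) h
  have hQ_ooxxcyc_y : cubeOp K ((x * x) * y) y = -((k : K) • (p * r)) + p * (b * b)
      - (2 * k : K) • (a * (q * b)) + (2 * k : K) • (a * (a * r)) - (k : K) • (b * (p * b))
      + (2 * k ^ 2 : K) • (b * (a * q)) := by
    rw [hopmul, hQ_oxxc_y, hQ_yy, hL_y, hL_oxxc]
    try simp only [mul_add, add_mul, mul_sub, sub_mul, neg_mul, mul_neg, smul_mul_assoc,
        mul_smul_comm, mul_assoc, mul_zero, zero_mul]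
    module
  have hQ_ooxxcyc_x : cubeOp K ((x * x) * y) x = -((k : K) • (p * q)) + p * (b * a)
      - (2 * k : K) • (a * (q * a)) + (2 * k : K) • (a * (a * q)) - (k : K) • (b * (p * a))
      + (2 * k ^ 2 : K) • (b * (a * p)) := by
    rw [hopmul, hQ_oxxc_y, hQ_yx, hQ_oxxc_x, hL_x, hL_oxxc, hL_y]
    try simp only [mul_add, add_mul, mul_sub, sub_mul, neg_mul, mul_neg, smul_mul_assoc,
        mul_smul_comm, mul_assoc, mul_zero, zero_mul]
    module
  have hL_ooxxcyc : mulLeft K ((x * x) * y) = -((2 * k : K) • (a * q)) - b * p + (2 : K)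
      • (a * (a * b)) + (2 : K) • (b * (a * a)) := by
    rw [mulLeft_mul_eq, hQ_oxxc_y, hL_oxxc, hL_y]
    try simp only [mul_add, add_mul, mul_sub, sub_mul, neg_mul, mul_neg, smul_mul_assoc,
        mul_smul_comm, mul_assoc, mul_zero, zero_mul]
    module
  have hQ_oooxxcycyc_x : cubeOp K (((x * x) * y) * y) x = -((k : K) • (p * (r * a)))
      + (2 * k ^ 2 : K) • (a * (q * q)) + (k ^ 2 + k : K) • (b * (p * q)) + p * (b * (b * a))
      - (2 * k : K) • (a * (q * (b * a))) + (2 * k : K) • (a * (a * (r * a))) - (2 * k : K)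
      • (a * (a * (b * q))) - (2 * k : K) • (b * (p * (b * a))) + (4 * k ^ 2 : K)
      • (b * (a * (q * a))) + (-2 * k ^ 2 - 2 * k : K) • (b * (a * (a * q))) + (k ^ 2 : K)
      • (b * (b * (p * a))) - (2 * k ^ 3 : K) • (b * (b * (a * p))) := by
    rw [hopmul, hQ_ooxxcyc_y, hQ_yx, hQ_ooxxcyc_x, hL_x, hL_ooxxcyc, hL_y]
    try simp only [mul_add, add_mul, mul_sub, sub_mul, neg_mul, mul_neg, smul_mul_assoc,
        mul_smul_comm, mul_assoc, mul_zero, zero_mul]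
    module
  have hQ_oooxycycxc_x : cubeOp K (((x * y) * y) * x) x = -((k : K) • (q * (q * a)))
      + (k ^ 2 : K) • (a * (q * q)) + (k ^ 2 : K) • (a * (r * p)) + (k ^ 2 + k : K)
      • (b * (q * p)) + q * (b * (a * a)) - (k : K) • (a * (q * (b * a))) - (k : K)
      • (a * (r * (a * a))) + (k ^ 2 : K) • (a * (a * (r * a))) - (k ^ 2 : K)
      • (a * (a * (b * q))) + (2 * k ^ 2 + k : K) • (a * (b * (q * a))) + (-k ^ 3 - k ^ 2 : K)
      • (a * (b * (a * q))) + (-k ^ 3 - k : K) • (a * (b * (b * p))) - (2 * k : K)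
      • (b * (q * (a * a))) + (k ^ 2 + k : K) • (b * (a * (q * a))) - (2 * k : K)
      • (b * (a * (b * p))) + (k ^ 2 : K) • (b * (b * (p * a))) - (k : K)
      • (b * (b * (a * p))) := by
    rw [hopmul, hQ_ooxycyc_x, hQ_xx, hL_x, hL_ooxycyc]
    try simp only [mul_add, add_mul, mul_sub, sub_mul, neg_mul, mul_neg, smul_mul_assoc,
        mul_smul_comm, mul_assoc, mul_zero, zero_mul]
    module
  have rel_op_y_y_x_x_x : (2 * k : K) • (p * (r * a)) + (4 * k ^ 2 : K) • (q * (q * a))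
      + (2 * k ^ 2 - 2 * k : K) • (r * (p * a)) + (-4 * k ^ 3 - 4 * k ^ 2 : K) • (a * (q * q))
      + (-6 * k ^ 3 + 2 * k : K) • (a * (r * p)) + (-2 * k ^ 2 - 2 * k : K) • (b * (p * q))
      - (8 * k ^ 3 : K) • (b * (q * p)) - (2 : K) • (p * (b * (b * a))) - (4 * k : K)
      • (q * (b * (a * a))) + (-2 * k + 2 : K) • (r * (a * (a * a))) + (4 * k ^ 2 + 4 * k : K)
      • (a * (q * (b * a))) + (8 * k ^ 2 - 4 * k : K) • (a * (r * (a * a))) + (-6 * k ^ 3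
      + 2 * k ^ 2 - 4 * k : K) • (a * (a * (r * a))) + (4 * k ^ 4 + 4 * k : K)
      • (a * (a * (b * q))) + (-16 * k ^ 3 + 4 * k ^ 2 : K) • (a * (b * (q * a))) + (4 * k ^ 4
      + 4 * k ^ 3 : K) • (a * (b * (a * q))) + (4 * k ^ 4 + 4 * k ^ 3 + 4 * k ^ 2 - 4 * k : K)
      • (a * (b * (b * p))) + (4 * k : K) • (b * (p * (b * a))) + (12 * k ^ 2 - 4 * k : K)
      • (b * (q * (a * a))) + (-4 * k ^ 3 - 12 * k ^ 2 : K) • (b * (a * (q * a))) + (4 * k ^ 2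
      + 4 * k : K) • (b * (a * (a * q))) + (8 * k ^ 2 : K) • (b * (a * (b * p))) + (-4 * k ^ 3
      - 6 * k ^ 2 + 4 * k : K) • (b * (b * (p * a))) + (4 * k ^ 3 + 8 * k ^ 2 - 4 * k : K)
      • (b * (b * (a * p))) = 0 := by
    have e : (-2 : K) • (((x * x) * y) * y) + (-4 * k : K) • (((x * y) * y) * x) + (-2 * k
        + 2 : K) • (((y * y) * x) * x) = 0 := by
      linear_combination (norm := (simp only [cubeForm, mul_add, add_mul, mul_comm]; module))
          hform y y x x
    -- Substituting the same relation into an argument of Q, instead of into L, yields a further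
    -- word relation, one degree higher.
    have h := congrArg (fun t => cubeOp K t x) e
    simp only [cubeOp_add, cubeOp_smul, cubeOp_zero, hQ_oooxxcycyc_x, hQ_oooxycycxc_x,
        hQ_oooyycxcxc_x] at h
    linear_combination (norm := ((try simp only [mul_add, add_mul, mul_sub, sub_mul, neg_mul,
        mul_neg, smul_mul_assoc, mul_smul_comm, mul_assoc, mul_zero, zero_mul]); module)) h
  have hL_oooxxcycyc : mulLeft K (((x * x) * y) * y) = -((k : K) • (p * r)) + p * (b * b)
      + (2 * k : K) • (a * (a * r)) + (-k + 1 : K) • (b * (p * b)) + (2 * k ^ 2 + 2 * k : K)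
      • (b * (a * q)) + b * (b * p) - (2 : K) • (a * (a * (b * b))) - (4 : K)
      • (b * (a * (a * b))) - (2 : K) • (b * (b * (a * a))) := by
    rw [mulLeft_mul_eq, hQ_ooxxcyc_y, hL_ooxxcyc, hL_y]
    try simp only [mul_add, add_mul, mul_sub, sub_mul, neg_mul, mul_neg, smul_mul_assoc,
        mul_smul_comm, mul_assoc, mul_zero, zero_mul]
    module
  have hL_oooxycycxc : mulLeft K (((x * y) * y) * x) = -((k : K) • (q * q)) + q * (b * a)
      + (k : K) • (a * (a * r)) + (2 * k + 1 : K) • (a * (b * q)) + (-k + 1 : K) • (b * (q * a))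
      + (k ^ 2 + k : K) • (b * (a * q)) + (k ^ 2 : K) • (b * (b * p)) - a * (a * (b * b))
      - (2 : K) • (a * (b * (a * b))) - (2 : K) • (a * (b * (b * a))) - (2 : K)
      • (b * (a * (b * a))) - b * (b * (a * a)) := by
    rw [mulLeft_mul_eq, hQ_ooxycyc_x, hL_ooxycyc, hL_x]
    try simp only [mul_add, add_mul, mul_sub, sub_mul, neg_mul, mul_neg, smul_mul_assoc,
        mul_smul_comm, mul_assoc, mul_zero, zero_mul]
    module
  have rel_form_y_y_x_x : (2 * k : K) • (p * r) + (4 * k ^ 2 : K) • (q * q) + (2 * k ^ 2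
      - 2 * k : K) • (r * p) - (2 : K) • (p * (b * b)) - (4 * k : K) • (q * (b * a)) + (-2 * k
      + 2 : K) • (r * (a * a)) + (2 * k ^ 2 - 4 * k + 2 : K) • (a * (r * a)) + (-4 * k ^ 2
      - 6 * k + 2 : K) • (a * (a * r)) + (-4 * k ^ 3 - 8 * k ^ 2 : K) • (a * (b * q)) + (2 * k
      - 2 : K) • (b * (p * b)) + (4 * k ^ 2 - 4 * k : K) • (b * (q * a)) + (-4 * k ^ 3
      - 8 * k ^ 2 - 4 * k : K) • (b * (a * q)) + (-4 * k ^ 3 - 4 * k ^ 2 + 4 * k - 2 : K)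
      • (b * (b * p)) + (8 * k : K) • (a * (a * (b * b))) + (8 * k : K) • (a * (b * (a * b)))
      + (16 * k - 8 : K) • (a * (b * (b * a))) + (8 : K) • (b * (a * (a * b))) + (8 * k : K)
      • (b * (a * (b * a))) + (8 * k : K) • (b * (b * (a * a))) = 0 := by
    have e : (-2 : K) • (((x * x) * y) * y) + (-4 * k : K) • (((x * y) * y) * x) + (-2 * k
        + 2 : K) • (((y * y) * x) * x) = 0 := by
      linear_combination (norm := (simp only [cubeForm, mul_add, add_mul, mul_comm]; module))
          hform y y x x
    have h := congrArg (mulLeft K) e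
    simp only [mulLeft_add', mulLeft_smul', mulLeft_zero', hL_oooxxcycyc, hL_oooxycycxc,
        hL_oooyycxcxc] at h
    linear_combination (norm := ((try simp only [mul_add, add_mul, mul_sub, sub_mul, neg_mul,
        mul_neg, smul_mul_assoc, mul_smul_comm, mul_assoc, mul_zero, zero_mul]); module)) h
  have hQ_x_ooxxcyc : cubeOp K x ((x * x) * y) = -((k : K) • (p * q)) + p * (b * a)
      - (2 * k : K) • (a * (q * a)) + (2 * k : K) • (a * (a * q)) - (k : K) • (b * (p * a))
      + (2 * k ^ 2 : K) • (b * (a * p)) := by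
    rw [cubeOp_comm, hQ_ooxxcyc_x]
  have hQ_y_ooxxcyc : cubeOp K y ((x * x) * y) = -((k : K) • (p * r)) + p * (b * b)
      - (2 * k : K) • (a * (q * b)) + (2 * k : K) • (a * (a * r)) - (k : K) • (b * (p * b))
      + (2 * k ^ 2 : K) • (b * (a * q)) := by
    rw [cubeOp_comm, hQ_ooxxcyc_y]
  have rel_sym_y_x_ooxxcyc : (k ^ 2 : K) • (a * (p * r)) + (2 * k ^ 2 : K) • (a * (q * q))
      + (k ^ 2 + k : K) • (b * (p * q)) - (k : K) • (a * (p * (b * b))) - (2 * k : K)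
      • (a * (q * (a * b))) - (2 * k : K) • (a * (q * (b * a))) + (2 * k ^ 2 - 2 * k : K)
      • (a * (a * (q * b))) - (2 * k ^ 2 : K) • (a * (a * (a * r))) - (2 * k : K)
      • (a * (a * (b * q))) + (k ^ 2 - 1 : K) • (a * (b * (p * b))) + (-2 * k ^ 3 - 2 * k : K)
      • (a * (b * (a * q))) - a * (b * (b * p)) - b * (p * (a * b)) + (-k - 1 : K)
      • (b * (p * (b * a))) + (2 * k ^ 2 - 2 * k : K) • (b * (a * (q * a))) + (-2 * k ^ 2
      - 4 * k : K) • (b * (a * (a * q))) - b * (a * (b * p)) + (k ^ 2 - 1 : K)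
      • (b * (b * (p * a))) - (2 * k ^ 3 : K) • (b * (b * (a * p))) + (2 : K)
      • (a * (a * (a * (b * b)))) + (2 : K) • (a * (a * (b * (a * b)))) + (2 : K)
      • (a * (a * (b * (b * a)))) + (4 : K) • (a * (b * (a * (a * b)))) + (2 : K)
      • (a * (b * (b * (a * a)))) + (4 : K) • (b * (a * (a * (a * b)))) + (4 : K)
      • (b * (a * (a * (b * a)))) + (2 : K) • (b * (a * (b * (a * a)))) + (2 : K)
      • (b * (b * (a * (a * a)))) = 0 := by
    have h := hsym y x ((x * x) * y)
    simp only [hL_y, hL_x, hL_ooxxcyc, hQ_x_ooxxcyc, hQ_y_ooxxcyc, hQ_yx] at h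
    linear_combination (norm := ((try simp only [mul_add, add_mul, mul_sub, sub_mul, neg_mul,
        mul_neg, smul_mul_assoc, mul_smul_comm, mul_assoc, mul_zero, zero_mul]); module)) h
  have hL_oooxxcxcyc : mulLeft K (((x * x) * x) * y) = -((k : K) • (p * q)) + p * (a * b) + (-k
      + 1 : K) • (a * (p * b)) + (2 * k ^ 2 + 2 * k : K) • (a * (a * q)) + (2 * k + 1 : K)
      • (b * (a * p)) - (4 : K) • (a * (a * (a * b))) - (4 : K) • (b * (a * (a * a))) := by
    rw [mulLeft_mul_eq, hQ_ooxxcxc_y, hL_ooxxcxc, hL_y]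
    try simp only [mul_add, add_mul, mul_sub, sub_mul, neg_mul, mul_neg, smul_mul_assoc,
        mul_smul_comm, mul_assoc, mul_zero, zero_mul]
    module
  have hL_oooxxcycxc : mulLeft K (((x * x) * y) * x) = -((k : K) • (p * q)) + p * (b * a)
      + (4 * k : K) • (a * (a * q)) + a * (b * p) + (-k + 1 : K) • (b * (p * a))
      + (2 * k ^ 2 : K) • (b * (a * p)) - (2 : K) • (a * (a * (a * b))) - (2 : K)
      • (a * (a * (b * a))) - (2 : K) • (a * (b * (a * a))) - (2 : K) • (b * (a * (a * a))) := by
    rw [mulLeft_mul_eq, hQ_ooxxcyc_x, hL_ooxxcyc, hL_x]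
    try simp only [mul_add, add_mul, mul_sub, sub_mul, neg_mul, mul_neg, smul_mul_assoc,
        mul_smul_comm, mul_assoc, mul_zero, zero_mul]
    module
  have hQ_ooxycxc_x : cubeOp K ((x * y) * x) x = -((k : K) • (q * p)) + q * (a * a)
      - (2 * k : K) • (a * (q * a)) + (k ^ 2 : K) • (a * (a * q)) + (k ^ 2 + k : K)
      • (a * (b * p)) - (k : K) • (b * (p * a)) + (k : K) • (b * (a * p)) := by
    rw [hopmul, hQ_oxyc_x, hQ_xx, hL_x, hL_oxyc]
    try simp only [mul_add, add_mul, mul_sub, sub_mul, neg_mul, mul_neg, smul_mul_assoc,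
        mul_smul_comm, mul_assoc, mul_zero, zero_mul]
    module
  have hL_ooxycxc : mulLeft K ((x * y) * x) = (-k - 1 : K) • (a * q) - (k : K) • (b * p)
      + a * (a * b) + (2 : K) • (a * (b * a)) + b * (a * a) := by
    rw [mulLeft_mul_eq, hQ_oxyc_x, hL_oxyc, hL_x]
    try simp only [mul_add, add_mul, mul_sub, sub_mul, neg_mul, mul_neg, smul_mul_assoc,
        mul_smul_comm, mul_assoc, mul_zero, zero_mul]
    module
  have hL_oooxycxcxc : mulLeft K (((x * y) * x) * x) = -((k : K) • (q * p)) + q * (a * a) + (-k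
      + 1 : K) • (a * (q * a)) + (k ^ 2 + k + 1 : K) • (a * (a * q)) + (k ^ 2 + 2 * k : K)
      • (a * (b * p)) + (k : K) • (b * (a * p)) - a * (a * (a * b)) - (3 : K)
      • (a * (a * (b * a))) - (3 : K) • (a * (b * (a * a))) - b * (a * (a * a)) := by
    rw [mulLeft_mul_eq, hQ_ooxycxc_x, hL_ooxycxc, hL_x]
    try simp only [mul_add, add_mul, mul_sub, sub_mul, neg_mul, mul_neg, smul_mul_assoc,
        mul_smul_comm, mul_assoc, mul_zero, zero_mul]
    module
  have rel_form_y_x_x_x : (2 * k ^ 2 + 2 * k : K) • (p * q) + (4 * k ^ 2 - 2 * k : K) • (q * p)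
      - p * (a * b) + (-2 * k - 1 : K) • (p * (b * a)) + (-4 * k + 2 : K) • (q * (a * a)) + (k
      - 1 : K) • (a * (p * b)) + (4 * k ^ 2 - 6 * k + 2 : K) • (a * (q * a)) + (-4 * k ^ 3
      - 12 * k ^ 2 - 8 * k + 2 : K) • (a * (a * q)) + (-4 * k ^ 3 - 6 * k ^ 2 + 2 * k - 1 : K)
      • (a * (b * p)) + (2 * k ^ 2 - k - 1 : K) • (b * (p * a)) + (-4 * k ^ 3 - 6 * k ^ 2
      - 1 : K) • (b * (a * p)) + (8 * k + 4 : K) • (a * (a * (a * b))) + (16 * k - 4 : K)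
      • (a * (a * (b * a))) + (16 * k - 4 : K) • (a * (b * (a * a))) + (8 * k + 4 : K)
      • (b * (a * (a * a))) = 0 := by
    have e : (-1 : K) • (((x * x) * x) * y) + (-2 * k - 1 : K) • (((x * x) * y) * x) + (-4 * k
        + 2 : K) • (((x * y) * x) * x) = 0 := by
      linear_combination (norm := (simp only [cubeForm, mul_add, add_mul, mul_comm]; module))
          hform y x x x
    have h := congrArg (mulLeft K) e
    simp only [mulLeft_add', mulLeft_smul', mulLeft_zero', hL_oooxxcxcyc, hL_oooxxcycxc,
        hL_oooxycxcxc] at h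
    linear_combination (norm := ((try simp only [mul_add, add_mul, mul_sub, sub_mul, neg_mul,
        mul_neg, smul_mul_assoc, mul_smul_comm, mul_assoc, mul_zero, zero_mul]); module)) h
  have hQ_oyyc_ooxxcxc : cubeOp K (y * y) ((x * x) * x) = (-2 * k - 1 : K) • (r * (a * p))
      + (2 * k ^ 2 : K) • (b * (p * q)) + (4 : K) • (r * (a * (a * a))) - (2 * k : K)
      • (b * (p * (a * b))) + (6 * k ^ 2 : K) • (b * (a * (p * b))) + (-4 * k ^ 3
      - 4 * k ^ 2 : K) • (b * (a * (a * q))) := by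
    rw [hopmul, hQ_yy, hQ_y_ooxxcxc, hL_ooxxcxc, hL_y]
    try simp only [mul_add, add_mul, mul_sub, sub_mul, neg_mul, mul_neg, smul_mul_assoc,
        mul_smul_comm, mul_assoc, mul_zero, zero_mul]
    module
  -- The recursion for Q splits its first argument only, so expanding Q_{u,v} and Q_{v,u} gives
  -- different words. The symmetry of Q turns their difference into a relation.
  have rV_oyyc_ooxxcxc : (k : K) • (p * (r * a)) - p * (a * r) - (2 * k ^ 2 : K) • (p * (b * q))
      + (-2 * k - 1 : K) • (r * (a * p)) + (3 * k : K) • (a * (p * r)) + (2 * k ^ 2 : K)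
      • (b * (p * q)) + (2 : K) • (p * (a * (b * b))) + (4 : K) • (r * (a * (a * a)))
      - (6 * k : K) • (a * (p * (b * b))) + (-2 * k ^ 2 - 2 * k : K) • (a * (a * (r * a)))
      + (4 * k ^ 3 + 4 * k ^ 2 : K) • (a * (a * (b * q))) - (2 * k : K) • (b * (p * (a * b)))
      + (6 * k ^ 2 : K) • (b * (a * (p * b))) + (-4 * k ^ 3 - 4 * k ^ 2 : K)
      • (b * (a * (a * q))) = 0 := by
    have h := cubeOp_comm (K := K) (y * y) ((x * x) * x)
    rw [hQ_oyyc_ooxxcxc, hQ_ooxxcxc_oyyc] at h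
    linear_combination (norm := ((try simp only [mul_add, add_mul, mul_sub, sub_mul, neg_mul,
        mul_neg, smul_mul_assoc, mul_smul_comm, mul_assoc, mul_zero, zero_mul]); module)) h
  have hQ_y_oxxc : cubeOp K y (x * x) = p * b - (2 * k : K) • (a * q) := by
    rw [cubeOp_comm, hQ_oxxc_y]
  have rel_sym_y_y_oxxc : -((k : K) • (p * r)) + (2 : K) • (p * (b * b)) + (2 * k : K)
      • (a * (a * r)) + (-2 * k + 2 : K) • (b * (p * b)) + (4 * k ^ 2 : K) • (b * (a * q))
      + (2 : K) • (b * (b * p)) - (4 : K) • (a * (a * (b * b))) - (4 : K) • (b * (a * (a * b)))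
      - (4 : K) • (b * (b * (a * a))) = 0 := by
    have h := hsym y y (x * x)
    simp only [hL_y, hL_oxxc, hQ_y_oxxc, hQ_yy] at h
    linear_combination (norm := ((try simp only [mul_add, add_mul, mul_sub, sub_mul, neg_mul,
        mul_neg, smul_mul_assoc, mul_smul_comm, mul_assoc, mul_zero, zero_mul]); module)) h
  have hQ_x_oxyc : cubeOp K x (x * y) = q * a - (k : K) • (a * q) - (k : K) • (b * p) := by
    rw [cubeOp_comm, hQ_oxyc_x]
  have hQ_y_oxyc : cubeOp K y (x * y) = q * b - (k : K) • (a * r) - (k : K) • (b * q) := by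
    rw [cubeOp_comm, hQ_oxyc_y]
  have rel_sym_y_x_oxyc : -((k : K) • (q * q)) + q * (a * b) + q * (b * a) + (-k + 1 : K)
      • (a * (q * b)) + (k ^ 2 : K) • (a * (a * r)) + (k ^ 2 + k + 1 : K) • (a * (b * q)) + (-k
      + 1 : K) • (b * (q * a)) + (k ^ 2 + k + 1 : K) • (b * (a * q)) + (k ^ 2 : K)
      • (b * (b * p)) - a * (a * (b * b)) - (3 : K) • (a * (b * (a * b))) - (2 : K)
      • (a * (b * (b * a))) - (2 : K) • (b * (a * (a * b))) - (3 : K) • (b * (a * (b * a)))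
      - b * (b * (a * a)) = 0 := by
    have h := hsym y x (x * y)
    simp only [hL_y, hL_x, hL_oxyc, hQ_x_oxyc, hQ_y_oxyc, hQ_yx] at h
    linear_combination (norm := ((try simp only [mul_add, add_mul, mul_sub, sub_mul, neg_mul,
        mul_neg, smul_mul_assoc, mul_smul_comm, mul_assoc, mul_zero, zero_mul]); module)) h
  have rel_sym_x_x_oyyc : -((k : K) • (r * p)) + (2 : K) • (r * (a * a)) + (-2 * k + 2 : K)
      • (a * (r * a)) + (2 : K) • (a * (a * r)) + (4 * k ^ 2 : K) • (a * (b * q)) + (2 * k : K)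
      • (b * (b * p)) - (4 : K) • (a * (a * (b * b))) - (4 : K) • (a * (b * (b * a))) - (4 : K)
      • (b * (b * (a * a))) = 0 := by
    have h := hsym x x (y * y)
    simp only [hL_x, hL_oyyc, hQ_x_oyyc, hQ_xx] at h
    linear_combination (norm := ((try simp only [mul_add, add_mul, mul_sub, sub_mul, neg_mul,
        mul_neg, smul_mul_assoc, mul_smul_comm, mul_assoc, mul_zero, zero_mul]); module)) h
  have rel_form_x_x_y_x : (4 * k ^ 2 - 2 * k : K) • (p * q) + (2 * k ^ 2 + 2 * k : K) • (q * p)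
      + (-3 * k + 1 : K) • (p * (a * b)) + (-k + 1 : K) • (p * (b * a)) + (-2 * k - 2 : K)
      • (q * (a * a)) + (3 * k ^ 2 - 4 * k + 1 : K) • (a * (p * b)) + (2 * k ^ 2 - 2 : K)
      • (a * (q * a)) + (-8 * k ^ 3 - 12 * k ^ 2 + 2 * k - 2 : K) • (a * (a * q)) + (-2 * k ^ 3
      - 6 * k ^ 2 - 5 * k + 1 : K) • (a * (b * p)) + (k ^ 2 - 2 * k + 1 : K) • (b * (p * a))
      + (-2 * k ^ 3 - 6 * k ^ 2 - 3 * k + 1 : K) • (b * (a * p)) + (16 * k - 4 : K)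
      • (a * (a * (a * b))) + (8 * k + 4 : K) • (a * (a * (b * a))) + (8 * k + 4 : K)
      • (a * (b * (a * a))) + (16 * k - 4 : K) • (b * (a * (a * a))) = 0 := by
    have e : (-3 * k + 1 : K) • (((x * x) * x) * y) + (-k + 1 : K) • (((x * x) * y) * x)
        + (-2 * k - 2 : K) • (((x * y) * x) * x) = 0 := by
      linear_combination (norm := (simp only [cubeForm, mul_add, add_mul, mul_comm]; module))
          hform x x y x
    have h := congrArg (mulLeft K) e
    simp only [mulLeft_add', mulLeft_smul', mulLeft_zero', hL_oooxxcxcyc, hL_oooxxcycxc,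
        hL_oooxycxcxc] at h
    linear_combination (norm := ((try simp only [mul_add, add_mul, mul_sub, sub_mul, neg_mul,
        mul_neg, smul_mul_assoc, mul_smul_comm, mul_assoc, mul_zero, zero_mul]); module)) h
  have hQ_x_ooyycxc : cubeOp K x ((y * y) * x) = -((k : K) • (r * p)) + r * (a * a) - (k : K)
      • (a * (r * a)) + (2 * k ^ 2 : K) • (a * (b * q)) - (2 * k : K) • (b * (q * a))
      + (2 * k : K) • (b * (b * p)) := by
    rw [cubeOp_comm, hQ_ooyycxc_x]
  have rel_sym_x_x_ooyycxc : (2 * k ^ 2 + k : K) • (a * (r * p)) + (2 * k ^ 2 : K)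
      • (b * (q * p)) + (-2 * k - 2 : K) • (a * (r * (a * a))) + (2 * k ^ 2 - 2 : K)
      • (a * (a * (r * a))) - (2 : K) • (a * (a * (a * r))) + (-4 * k ^ 3 - 4 * k : K)
      • (a * (a * (b * q))) + (4 * k ^ 2 - 4 * k : K) • (a * (b * (q * a))) + (-4 * k ^ 2
      - 2 * k : K) • (a * (b * (b * p))) - (4 * k : K) • (b * (q * (a * a))) - (2 * k : K)
      • (b * (b * (a * p))) + (4 : K) • (a * (a * (a * (b * b)))) + (8 : K)
      • (a * (a * (b * (b * a)))) + (8 : K) • (a * (b * (b * (a * a)))) + (4 : K)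
      • (b * (b * (a * (a * a)))) = 0 := by
    have h := hsym x x ((y * y) * x)
    simp only [hL_x, hL_ooyycxc, hQ_x_ooyycxc, hQ_xx] at h
    linear_combination (norm := ((try simp only [mul_add, add_mul, mul_sub, sub_mul, neg_mul,
        mul_neg, smul_mul_assoc, mul_smul_comm, mul_assoc, mul_zero, zero_mul]); module)) h
  have hQ_oooxxcxcyc_y : cubeOp K (((x * x) * x) * y) y = -((k : K) • (p * (q * b)))
      + (2 * k ^ 2 + k : K) • (a * (p * r)) + (k ^ 2 : K) • (b * (p * q)) + p * (a * (b * b))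
      - (3 * k : K) • (a * (p * (b * b))) + (2 * k ^ 2 + 2 * k : K) • (a * (a * (q * b)))
      - (4 * k : K) • (a * (a * (a * r))) - (k : K) • (b * (p * (a * b))) + (3 * k ^ 2 : K)
      • (b * (a * (p * b))) + (-2 * k ^ 3 - 2 * k ^ 2 : K) • (b * (a * (a * q))) := by
    rw [hopmul, hQ_ooxxcxc_y, hQ_yy, hL_y, hL_ooxxcxc]
    try simp only [mul_add, add_mul, mul_sub, sub_mul, neg_mul, mul_neg, smul_mul_assoc,
        mul_smul_comm, mul_assoc, mul_zero, zero_mul]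
    module
  have hQ_oooxxcycxc_y : cubeOp K (((x * x) * y) * x) y = -((k : K) • (p * (q * b)))
      + (k ^ 2 : K) • (a * (p * r)) + (2 * k ^ 2 : K) • (a * (q * q)) + (k : K) • (b * (p * q))
      + p * (b * (a * b)) - (k : K) • (a * (p * (b * b))) - (2 * k : K) • (a * (q * (a * b)))
      + (2 * k ^ 2 + 2 * k : K) • (a * (a * (q * b))) - (2 * k ^ 2 : K) • (a * (a * (a * r)))
      - (2 * k : K) • (a * (a * (b * q))) + (k ^ 2 : K) • (a * (b * (p * b))) - (2 * k ^ 3 : K)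
      • (a * (b * (a * q))) - (k : K) • (b * (p * (a * b))) + (2 * k ^ 2 : K)
      • (b * (a * (p * b))) - (2 * k : K) • (b * (a * (a * q))) := by
    rw [hopmul, hQ_ooxxcyc_x, hQ_xy, hQ_ooxxcyc_y, hL_y, hL_ooxxcyc, hL_x]
    try simp only [mul_add, add_mul, mul_sub, sub_mul, neg_mul, mul_neg, smul_mul_assoc,
        mul_smul_comm, mul_assoc, mul_zero, zero_mul]
    module
  have hQ_ooxycxc_y : cubeOp K ((x * y) * x) y = -((k : K) • (q * q)) + q * (a * b)
      - (2 * k : K) • (a * (q * b)) + (k ^ 2 : K) • (a * (a * r)) + (k ^ 2 + k : K)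
      • (a * (b * q)) - (k : K) • (b * (p * b)) + (k : K) • (b * (a * q)) := by
    rw [hopmul, hQ_oxyc_x, hQ_xy, hQ_oxyc_y, hL_y, hL_oxyc, hL_x]
    try simp only [mul_add, add_mul, mul_sub, sub_mul, neg_mul, mul_neg, smul_mul_assoc,
        mul_smul_comm, mul_assoc, mul_zero, zero_mul]
    module
  have hQ_oooxycxcxc_y : cubeOp K (((x * y) * x) * x) y = -((k : K) • (q * (p * b)))
      + (2 * k ^ 2 + k : K) • (a * (q * q)) + (k ^ 2 : K) • (b * (p * q)) + q * (a * (a * b))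
      - (3 * k : K) • (a * (q * (a * b))) + (3 * k ^ 2 : K) • (a * (a * (q * b))) - (k ^ 3 : K)
      • (a * (a * (a * r))) + (-k ^ 3 - k ^ 2 - k : K) • (a * (a * (b * q))) + (2 * k ^ 2
      + k : K) • (a * (b * (p * b))) + (-k ^ 2 - 2 * k : K) • (a * (b * (a * q))) - (k : K)
      • (b * (p * (a * b))) + (k : K) • (b * (a * (p * b))) - (k : K) • (b * (a * (a * q))) := by
    rw [hopmul, hQ_ooxycxc_x, hQ_xy, hQ_ooxycxc_y, hL_y, hL_ooxycxc, hL_x]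
    try simp only [mul_add, add_mul, mul_sub, sub_mul, neg_mul, mul_neg, smul_mul_assoc,
        mul_smul_comm, mul_assoc, mul_zero, zero_mul]
    module
  have rel_op_y_x_x_x_y : (2 * k ^ 2 + 2 * k : K) • (p * (q * b)) + (4 * k ^ 2 - 2 * k : K)
      • (q * (p * b)) + (-2 * k ^ 3 - 3 * k ^ 2 - k : K) • (a * (p * r)) + (-12 * k ^ 3
      - 2 * k ^ 2 + 2 * k : K) • (a * (q * q)) + (-4 * k ^ 3 - k ^ 2 - k : K) • (b * (p * q))
      - p * (a * (b * b)) + (-2 * k - 1 : K) • (p * (b * (a * b))) + (-4 * k + 2 : K)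
      • (q * (a * (a * b))) + (2 * k ^ 2 + 4 * k : K) • (a * (p * (b * b))) + (16 * k ^ 2
      - 4 * k : K) • (a * (q * (a * b))) + (-16 * k ^ 3 - 2 * k ^ 2 - 4 * k : K)
      • (a * (a * (q * b))) + (4 * k ^ 4 + 2 * k ^ 3 + 2 * k ^ 2 + 4 * k : K)
      • (a * (a * (a * r))) + (4 * k ^ 4 + 2 * k ^ 3 + 6 * k ^ 2 : K) • (a * (a * (b * q)))
      + (-10 * k ^ 3 - k ^ 2 + 2 * k : K) • (a * (b * (p * b))) + (4 * k ^ 4 + 6 * k ^ 3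
      + 6 * k ^ 2 - 4 * k : K) • (a * (b * (a * q))) + (6 * k ^ 2 : K) • (b * (p * (a * b)))
      + (-4 * k ^ 3 - 9 * k ^ 2 + 2 * k : K) • (b * (a * (p * b))) + (2 * k ^ 3
      + 10 * k ^ 2 : K) • (b * (a * (a * q))) = 0 := by
    have e : (-1 : K) • (((x * x) * x) * y) + (-2 * k - 1 : K) • (((x * x) * y) * x) + (-4 * k
        + 2 : K) • (((x * y) * x) * x) = 0 := by
      linear_combination (norm := (simp only [cubeForm, mul_add, add_mul, mul_comm]; module))
          hform y x x x
    have h := congrArg (fun t => cubeOp K t y) e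
    simp only [cubeOp_add, cubeOp_smul, cubeOp_zero, hQ_oooxxcxcyc_y, hQ_oooxxcycxc_y,
        hQ_oooxycxcxc_y] at h
    linear_combination (norm := ((try simp only [mul_add, add_mul, mul_sub, sub_mul, neg_mul,
        mul_neg, smul_mul_assoc, mul_smul_comm, mul_assoc, mul_zero, zero_mul]); module)) h
  have rel_op_x_x_y_x_y : (4 * k ^ 2 - 2 * k : K) • (p * (q * b)) + (2 * k ^ 2 + 2 * k : K)
      • (q * (p * b)) + (-7 * k ^ 3 + k : K) • (a * (p * r)) + (-6 * k ^ 3 - 4 * k ^ 2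
      - 2 * k : K) • (a * (q * q)) + (-5 * k ^ 3 - 2 * k ^ 2 + k : K) • (b * (p * q)) + (-3 * k
      + 1 : K) • (p * (a * (b * b))) + (-k + 1 : K) • (p * (b * (a * b))) + (-2 * k - 2 : K)
      • (q * (a * (a * b))) + (10 * k ^ 2 - 4 * k : K) • (a * (p * (b * b))) + (8 * k ^ 2
      + 4 * k : K) • (a * (q * (a * b))) + (-14 * k ^ 3 - 10 * k ^ 2 + 4 * k : K)
      • (a * (a * (q * b))) + (2 * k ^ 4 + 4 * k ^ 3 + 10 * k ^ 2 - 4 * k : K)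
      • (a * (a * (a * r))) + (2 * k ^ 4 + 4 * k ^ 3 + 6 * k ^ 2 : K) • (a * (a * (b * q)))
      + (-5 * k ^ 3 - 5 * k ^ 2 - 2 * k : K) • (a * (b * (p * b))) + (2 * k ^ 4 + 6 * k ^ 2
      + 4 * k : K) • (a * (b * (a * q))) + (6 * k ^ 2 : K) • (b * (p * (a * b))) + (-11 * k ^ 3
      + 3 * k ^ 2 - 2 * k : K) • (b * (a * (p * b))) + (6 * k ^ 4 + 4 * k ^ 3 + 2 * k ^ 2 : K)
      • (b * (a * (a * q))) = 0 := by
    have e : (-3 * k + 1 : K) • (((x * x) * x) * y) + (-k + 1 : K) • (((x * x) * y) * x)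
        + (-2 * k - 2 : K) • (((x * y) * x) * x) = 0 := by
      linear_combination (norm := (simp only [cubeForm, mul_add, add_mul, mul_comm]; module))
          hform x x y x
    have h := congrArg (fun t => cubeOp K t y) e
    simp only [cubeOp_add, cubeOp_smul, cubeOp_zero, hQ_oooxxcxcyc_y, hQ_oooxxcycxc_y,
        hQ_oooxycxcxc_y] at h
    linear_combination (norm := ((try simp only [mul_add, add_mul, mul_sub, sub_mul, neg_mul,
        mul_neg, smul_mul_assoc, mul_smul_comm, mul_assoc, mul_zero, zero_mul]); module)) h
  have hL_oooxycxcyc : mulLeft K (((x * y) * x) * y) = -((k : K) • (q * q)) + q * (a * b) + (-k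
      + 1 : K) • (a * (q * b)) + (k ^ 2 : K) • (a * (a * r)) + (k ^ 2 + k : K) • (a * (b * q))
      + (2 * k + 1 : K) • (b * (a * q)) + (k : K) • (b * (b * p)) - a * (a * (b * b)) - (2 : K)
      • (a * (b * (a * b))) - (2 : K) • (b * (a * (a * b))) - (2 : K) • (b * (a * (b * a)))
      - b * (b * (a * a)) := by
    rw [mulLeft_mul_eq, hQ_ooxycxc_y, hL_ooxycxc, hL_y]
    try simp only [mul_add, add_mul, mul_sub, sub_mul, neg_mul, mul_neg, smul_mul_assoc,
        mul_smul_comm, mul_assoc, mul_zero, zero_mul]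
    module
  have rel_form_x_x_y_y : (2 * k ^ 2 - 2 * k : K) • (p * r) + (4 * k ^ 2 : K) • (q * q)
      + (2 * k : K) • (r * p) + (-2 * k + 2 : K) • (p * (b * b)) - (4 * k : K) • (q * (a * b))
      - (2 : K) • (r * (a * a)) + (4 * k ^ 2 - 4 * k : K) • (a * (q * b)) + (2 * k - 2 : K)
      • (a * (r * a)) + (-4 * k ^ 3 - 4 * k ^ 2 + 4 * k - 2 : K) • (a * (a * r)) + (-4 * k ^ 3
      - 8 * k ^ 2 - 4 * k : K) • (a * (b * q)) + (2 * k ^ 2 - 4 * k + 2 : K) • (b * (p * b))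
      + (-4 * k ^ 3 - 8 * k ^ 2 : K) • (b * (a * q)) + (-4 * k ^ 2 - 6 * k + 2 : K)
      • (b * (b * p)) + (8 * k : K) • (a * (a * (b * b))) + (8 * k : K) • (a * (b * (a * b)))
      + (8 : K) • (a * (b * (b * a))) + (16 * k - 8 : K) • (b * (a * (a * b))) + (8 * k : K)
      • (b * (a * (b * a))) + (8 * k : K) • (b * (b * (a * a))) = 0 := by
    have e : (-2 * k + 2 : K) • (((x * x) * y) * y) + (-4 * k : K) • (((x * y) * x) * y)
        + (-2 : K) • (((y * y) * x) * x) = 0 := by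
      linear_combination (norm := (simp only [cubeForm, mul_add, add_mul, mul_comm]; module))
          hform x x y y
    have h := congrArg (mulLeft K) e
    simp only [mulLeft_add', mulLeft_smul', mulLeft_zero', hL_oooxxcycyc, hL_oooxycxcyc,
        hL_oooyycxcxc] at h
    linear_combination (norm := ((try simp only [mul_add, add_mul, mul_sub, sub_mul, neg_mul,
        mul_neg, smul_mul_assoc, mul_smul_comm, mul_assoc, mul_zero, zero_mul]); module)) h
  have hQ_x_oxxc : cubeOp K x (x * x) = p * a - (2 * k : K) • (a * p) := by
    rw [cubeOp_comm, hQ_oxxc_x]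
  have rel_sym_y_x_oxxc : -((k : K) • (p * q)) + p * (a * b) + p * (b * a) + (-k + 1 : K)
      • (a * (p * b)) + (2 * k ^ 2 + 2 * k : K) • (a * (a * q)) + a * (b * p) + (-k + 1 : K)
      • (b * (p * a)) + (2 * k ^ 2 + 1 : K) • (b * (a * p)) - (4 : K) • (a * (a * (a * b)))
      - (2 : K) • (a * (a * (b * a))) - (2 : K) • (a * (b * (a * a))) - (4 : K)
      • (b * (a * (a * a))) = 0 := by
    have h := hsym y x (x * x)
    simp only [hL_y, hL_x, hL_oxxc, hQ_x_oxxc, hQ_y_oxxc, hQ_yx] at h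
    linear_combination (norm := ((try simp only [mul_add, add_mul, mul_sub, sub_mul, neg_mul,
        mul_neg, smul_mul_assoc, mul_smul_comm, mul_assoc, mul_zero, zero_mul]); module)) h
  have hQ_oyyc_oxxc : cubeOp K (y * y) (x * x) = r * p - (2 : K) • (r * (a * a)) - (2 * k : K)
      • (b * (p * b)) + (4 * k ^ 2 : K) • (b * (a * q)) := by
    rw [hopmul, hQ_yy, hQ_y_oxxc, hL_oxxc, hL_y]
    try simp only [mul_add, add_mul, mul_sub, sub_mul, neg_mul, mul_neg, smul_mul_assoc,
        mul_smul_comm, mul_assoc, mul_zero, zero_mul]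
    module
  have rel_sym_x_oyyc_oxxc : (-k + 1 : K) • (p * (r * a)) + p * (a * r) + (2 * k ^ 2 : K)
      • (p * (b * q)) + (-k + 1 : K) • (r * (p * a)) + (2 * k ^ 2 + 1 : K) • (r * (a * p))
      + a * (p * r) + (-k + 1 : K) • (a * (r * p)) - (2 : K) • (p * (a * (b * b))) - (2 : K)
      • (p * (b * (b * a))) - (4 : K) • (r * (a * (a * a))) - (2 : K) • (a * (p * (b * b)))
      + (2 * k - 2 : K) • (a * (r * (a * a))) + (2 * k - 2 : K) • (a * (a * (r * a))) - (4 : K)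
      • (a * (a * (a * r))) - (4 * k ^ 2 : K) • (a * (a * (b * q))) + (2 * k ^ 2 : K)
      • (a * (b * (p * b))) - (4 * k ^ 3 : K) • (a * (b * (a * q))) - (2 : K)
      • (a * (b * (b * p))) + (2 * k - 2 : K) • (b * (b * (p * a))) + (-4 * k ^ 2 - 2 : K)
      • (b * (b * (a * p))) + (8 : K) • (a * (a * (a * (b * b)))) + (4 : K)
      • (a * (a * (b * (b * a)))) + (4 : K) • (a * (b * (b * (a * a)))) + (8 : K)
      • (b * (b * (a * (a * a)))) = 0 := by
    have h := hsym x (y * y) (x * x)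
    simp only [hL_x, hL_oyyc, hL_oxxc, hQ_oyyc_oxxc, hQ_x_oxxc, hQ_x_oyyc] at h
    linear_combination (norm := ((try simp only [mul_add, add_mul, mul_sub, sub_mul, neg_mul,
        mul_neg, smul_mul_assoc, mul_smul_comm, mul_assoc, mul_zero, zero_mul]); module)) h
  have rel_sym_x_x_oxyc : -((k : K) • (q * p)) + (2 : K) • (q * (a * a)) + (-2 * k + 2 : K)
      • (a * (q * a)) + (2 * k ^ 2 + 2 : K) • (a * (a * q)) + (2 * k ^ 2 + k : K)
      • (a * (b * p)) + (k : K) • (b * (a * p)) - (2 : K) • (a * (a * (a * b))) - (4 : K)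
      • (a * (a * (b * a))) - (4 : K) • (a * (b * (a * a))) - (2 : K) • (b * (a * (a * a)))
      = 0 := by
    have h := hsym x x (x * y)
    simp only [hL_x, hL_oxyc, hQ_x_oxyc, hQ_xx] at h
    linear_combination (norm := ((try simp only [mul_add, add_mul, mul_sub, sub_mul, neg_mul,
        mul_neg, smul_mul_assoc, mul_smul_comm, mul_assoc, mul_zero, zero_mul]); module)) h
  have rV_oyyc_oxxc : -(p * r) + r * p + (2 : K) • (p * (b * b)) - (2 : K) • (r * (a * a))
      + (2 * k : K) • (a * (r * a)) - (4 * k ^ 2 : K) • (a * (b * q)) - (2 * k : K)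
      • (b * (p * b)) + (4 * k ^ 2 : K) • (b * (a * q)) = 0 := by
    have h := cubeOp_comm (K := K) (y * y) (x * x)
    rw [hQ_oyyc_oxxc, hQ_oxxc_oyyc] at h
    linear_combination (norm := ((try simp only [mul_add, add_mul, mul_sub, sub_mul, neg_mul,
        mul_neg, smul_mul_assoc, mul_smul_comm, mul_assoc, mul_zero, zero_mul]); module)) h
  have hQ_oxxc_oxyc : cubeOp K (x * x) (x * y) = p * q - p * (a * b) - p * (b * a) - (2 * k : K)
      • (a * (q * a)) + (2 * k ^ 2 : K) • (a * (a * q)) + (2 * k ^ 2 : K) • (a * (b * p)) := by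
    rw [hopmul, hQ_xx, hQ_x_oxyc, hL_oxyc, hL_x]
    try simp only [mul_add, add_mul, mul_sub, sub_mul, neg_mul, mul_neg, smul_mul_assoc,
        mul_smul_comm, mul_assoc, mul_zero, zero_mul]
    module
  have hQ_oxyc_oxxc : cubeOp K (x * y) (x * x) = q * p - (2 : K) • (q * (a * a)) - (k : K)
      • (a * (p * b)) + (2 * k ^ 2 : K) • (a * (a * q)) - (k : K) • (b * (p * a))
      + (2 * k ^ 2 : K) • (b * (a * p)) := by
    rw [hopmul, hQ_xy, hQ_y_oxxc, hQ_x_oxxc, hL_oxxc, hL_x, hL_y]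
    try simp only [mul_add, add_mul, mul_sub, sub_mul, neg_mul, mul_neg, smul_mul_assoc,
        mul_smul_comm, mul_assoc, mul_zero, zero_mul]
    module
  have rV_oxxc_oxyc : p * q - q * p - p * (a * b) - p * (b * a) + (2 : K) • (q * (a * a))
      + (k : K) • (a * (p * b)) - (2 * k : K) • (a * (q * a)) + (2 * k ^ 2 : K) • (a * (b * p))
      + (k : K) • (b * (p * a)) - (2 * k ^ 2 : K) • (b * (a * p)) = 0 := by
    have h := cubeOp_comm (K := K) (x * x) (x * y)
    rw [hQ_oxxc_oxyc, hQ_oxyc_oxxc] at h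
    linear_combination (norm := ((try simp only [mul_add, add_mul, mul_sub, sub_mul, neg_mul,
        mul_neg, smul_mul_assoc, mul_smul_comm, mul_assoc, mul_zero, zero_mul]); module)) h
  have hQ_oxxc_ooyycxc : cubeOp K (x * x) ((y * y) * x) = -(p * (a * r)) - (2 * k : K)
      • (p * (b * q)) + (2 * k ^ 2 : K) • (a * (r * p)) + (2 : K) • (p * (a * (b * b)))
      + (2 : K) • (p * (b * (b * a))) - (2 * k : K) • (a * (r * (a * a))) + (2 * k ^ 2 : K)
      • (a * (a * (r * a))) - (4 * k ^ 3 : K) • (a * (a * (b * q))) + (4 * k ^ 2 : K)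
      • (a * (b * (q * a))) - (4 * k ^ 2 : K) • (a * (b * (b * p))) := by
    rw [hopmul, hQ_xx, hQ_x_ooyycxc, hL_ooyycxc, hL_x]
    try simp only [mul_add, add_mul, mul_sub, sub_mul, neg_mul, mul_neg, smul_mul_assoc,
        mul_smul_comm, mul_assoc, mul_zero, zero_mul]
    module
  have hQ_ooyycxc_oxxc : cubeOp K ((y * y) * x) (x * x) = -((k : K) • (r * (p * a)))
      + (2 * k ^ 2 + 1 : K) • (r * (a * p)) - (k : K) • (a * (r * p)) - (2 * k : K)
      • (b * (q * p)) - (2 : K) • (r * (a * (a * a))) + (2 * k : K) • (a * (r * (a * a)))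
      + (2 * k ^ 2 : K) • (a * (b * (p * b))) - (4 * k ^ 3 : K) • (a * (b * (a * q)))
      + (4 * k : K) • (b * (q * (a * a))) + (2 * k : K) • (b * (b * (p * a))) - (4 * k ^ 2 : K)
      • (b * (b * (a * p))) := by
    rw [hopmul, hQ_oyyc_x, hQ_x_oxxc, hQ_oyyc_oxxc, hL_oxxc, hL_oyyc, hL_x]
    try simp only [mul_add, add_mul, mul_sub, sub_mul, neg_mul, mul_neg, smul_mul_assoc,
        mul_smul_comm, mul_assoc, mul_zero, zero_mul]
    module
  have rV_oxxc_ooyycxc : -(p * (a * r)) - (2 * k : K) • (p * (b * q)) + (k : K) • (r * (p * a))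
      + (-2 * k ^ 2 - 1 : K) • (r * (a * p)) + (2 * k ^ 2 + k : K) • (a * (r * p)) + (2 * k : K)
      • (b * (q * p)) + (2 : K) • (p * (a * (b * b))) + (2 : K) • (p * (b * (b * a))) + (2 : K)
      • (r * (a * (a * a))) - (4 * k : K) • (a * (r * (a * a))) + (2 * k ^ 2 : K)
      • (a * (a * (r * a))) - (4 * k ^ 3 : K) • (a * (a * (b * q))) - (2 * k ^ 2 : K)
      • (a * (b * (p * b))) + (4 * k ^ 2 : K) • (a * (b * (q * a))) + (4 * k ^ 3 : K)
      • (a * (b * (a * q))) - (4 * k ^ 2 : K) • (a * (b * (b * p))) - (4 * k : K)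
      • (b * (q * (a * a))) - (2 * k : K) • (b * (b * (p * a))) + (4 * k ^ 2 : K)
      • (b * (b * (a * p))) = 0 := by
    have h := cubeOp_comm (K := K) (x * x) ((y * y) * x)
    rw [hQ_oxxc_ooyycxc, hQ_ooyycxc_oxxc] at h
    linear_combination (norm := ((try simp only [mul_add, add_mul, mul_sub, sub_mul, neg_mul,
        mul_neg, smul_mul_assoc, mul_smul_comm, mul_assoc, mul_zero, zero_mul]); module)) h
  -- The generic combination below yields the claim times 24 k²(k-1)³(k²-k-1). When the quadratic
  -- factor vanishes another combination is needed, and it has the harmless factor 6.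
  by_cases hk : k ^ 2 - k - 1 = 0
  -- This combination is correct only modulo k² = k + 1; the multiple of `hk` at its end collects
  -- the corrections.
  · have h : (6 : K) • (a * (p * r)) = 0 := by
      linear_combination (norm := ((try simp only [mul_add, add_mul, mul_sub, sub_mul, neg_mul,
          mul_neg, smul_mul_assoc, mul_smul_comm, mul_assoc, mul_zero, zero_mul]); module)) (-4 *
          k + 8 : K) • (rel_op_x_x_y_x_y)
        + (48 * k - 24 : K) • (rel_sym_y_x_x * q)
        + (30 * k - 60 : K) • (rel_sym_y_x_x * (a * b))
        + (6 * k : K) • (rel_sym_y_x_oxxc * b)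
        + (-12 * k - 18 : K) • (rel_sym_y_y_ooxxcxc)
        + (-20 * k : K) • ((b * b) * rel_sym_x_x_x)
        + (27 * k + 12 : K) • (rel_sym_x_oyyc_oxxc)
        + (3 * k : K) • (rel_sym_x_x_oyyc * a)
        + (-24 * k + 60 : K) • ((a * rel_sym_y_y_x) * a)
        + (48 : K) • ((a * b) * rel_sym_y_x_x)
        + (30 * k - 6 : K) • (a * rel_sym_y_y_oxxc)
        + (60 * k - 84 : K) • ((a * rel_sym_y_x_x) * b)
        + (48 * k + 24 : K) • (a * rel_sym_y_x_oxyc)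
        + (18 * k - 6 : K) • (a * rel_sym_x_x_oyyc)
        + (-6 * k - 12 : K) • (rel_sym_x_x_oxyc * b)
        + (-60 * k + 72 : K) • ((a * a) * rel_sym_y_y_x)
        + (27 * k + 18 : K) • (a * rV_oyyc_oxxc)
        + (6 * k + 6 : K) • (rV_oxxc_oxyc * b)
        + (-3 * k - 2 : K) • (rel_sym_x_x_x * r)
        + (6 * k + 18 : K) • (a * rel_form_y_y_x_x)
        + (18 * k - 16 : K) • (rel_form_y_x_x_x * b)
        + (-12 * k + 12 : K) • (a * rel_form_x_x_y_y)
        + (-3 * k - 24 : K) • (rel_sym_x_x_ooyycxc)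
        + (-24 : K) • (rel_sym_x_x_ooxycyc)
        + (48 : K) • (rel_sym_y_y_x * (a * a))
        + (-24 * k : K) • (rel_sym_y_y_x * p)
        + (12 * k + 18 : K) • (rV_oyyc_ooxxcxc)
        + (-10 : K) • (rel_form_x_x_y_x * b)
        + (-16 * k + 20 : K) • (rel_op_y_x_x_x_y)
        + (6 * k + 4 : K) • (r * rel_sym_x_x_x)
        + (6 * k + 6 : K) • (p * rel_sym_y_y_x)
        + (4 * k : K) • (rel_form_oyyc_x_x_x)
        + (9 * k + 3 : K) • (rV_oxxc_ooyycxc)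
        + (-5 * k : K) • (rel_form_x_x_oyyc_x)
        + (20 * k + 20 : K) • ((b * rel_sym_x_x_x) * b) - hk • ((-12 * k - 6 : K)
            • (p * (q * b)) + (-12 * k - 12 : K) • (p * (r * a)) + (9 : K) • (p * (a * r))
            + (24 * k ^ 2 + 18 * k : K) • (p * (b * q)) + (6 : K) • (q * (p * b)) + (3 * k
            - 12 : K) • (r * (p * a)) + (-6 * k ^ 2 + 42 * k + 9 : K) • (r * (a * p))
            + (60 * k ^ 2 - 51 * k + 12 : K) • (a * (p * r)) + (216 * k ^ 2 - 48 * k : K)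
            • (a * (q * q)) + (-6 * k ^ 2 + 24 * k - 30 : K) • (a * (r * p)) + (84 * k ^ 2
            - 12 * k : K) • (b * (p * q)) + (-12 * k ^ 2 + 18 * k : K) • (b * (q * p))
            - (18 : K) • (p * (a * (b * b))) + (6 : K) • (p * (b * (b * a))) - (54 : K)
            • (r * (a * (a * a))) + (-42 * k - 30 : K) • (a * (p * (b * b))) + (-216 * k
            + 12 : K) • (a * (q * (a * b))) - (24 : K) • (a * (q * (b * a))) + (6 * k + 12 : K)
            • (a * (r * (a * a))) + (240 * k ^ 2 - 240 * k + 12 : K) • (a * (a * (q * b)))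
            + (24 * k ^ 2 + 36 * k - 24 : K) • (a * (a * (r * a))) + (-72 * k ^ 3 + 24 * k ^ 2
            - 24 * k + 12 : K) • (a * (a * (a * r))) + (-120 * k ^ 3 - 48 * k ^ 2 - 96 * k
            - 24 : K) • (a * (a * (b * q))) + (108 * k ^ 2 - 108 * k + 18 : K)
            • (a * (b * (p * b))) + (-12 * k ^ 2 + 96 * k - 72 : K) • (a * (b * (q * a)))
            + (-72 * k ^ 3 - 120 * k ^ 2 + 24 * k + 24 : K) • (a * (b * (a * q))) + (-12 * k ^ 2
            + 48 : K) • (a * (b * (b * p))) + (-84 * k - 6 : K) • (b * (p * (a * b))) + (12 * k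
            - 48 : K) • (b * (q * (a * a))) + (36 * k ^ 2 - 24 * k - 42 : K)
            • (b * (a * (p * b))) + (-24 * k ^ 3 - 24 * k ^ 2 - 144 * k + 48 : K)
            • (b * (a * (a * q))) + (-6 * k + 24 : K) • (b * (b * (p * a))) + (12 * k ^ 2
            - 72 * k - 12 : K) • (b * (b * (a * p))) + (192 : K) • (a * (a * (a * (b * b))))
            + (240 : K) • (a * (a * (b * (a * b)))) + (48 : K) • (a * (a * (b * (b * a))))
            + (96 : K) • (a * (b * (a * (a * b)))) - (48 : K) • (a * (b * (a * (b * a))))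
            - (96 : K) • (a * (b * (b * (a * a)))) + (144 : K) • (b * (a * (a * (a * b))))
            + (96 : K) • (b * (b * (a * (a * a)))))
    have h6 : (6 : K) ≠ 0 := by
      rw [show (6 : K) = 2 * 3 by norm_num]; exact mul_ne_zero h2 h3
    exact (smul_eq_zero.1 h).resolve_left h6
  · have h : (24 * k ^ 2 * (k - 1) ^ 3 * (k ^ 2 - k - 1) : K) • (a * (p * r)) = 0 := by
      linear_combination (norm := ((try simp only [mul_add, add_mul, mul_sub, sub_mul, neg_mul,
          mul_neg, smul_mul_assoc, mul_smul_comm, mul_assoc, mul_zero, zero_mul]); module)) (2 * k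
          ^ 3 + k ^ 2 - 2 * k - 1 : K) • (rel_form_x_x_oyyc_x)
        + (8 * k ^ 4 + 4 * k ^ 3 + 12 * k ^ 2 : K) • ((b * b) * rel_sym_x_x_x)
        + (-6 * k ^ 3 - 6 * k ^ 2 : K) • (rel_sym_y_y_ooxxcxc)
        + (-48 * k ^ 4 + 48 * k ^ 3 - 60 * k ^ 2 - 12 * k : K) • (rel_sym_y_x_x * (a * b))
        + (48 * k ^ 5 - 48 * k ^ 4 + 48 * k ^ 3 : K) • (rel_sym_y_x_x * q)
        + (-k ^ 3 + k ^ 2 + k - 1 : K) • (rel_form_oyyc_x_x_x)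
        + (-8 * k ^ 4 - 4 * k ^ 3 + 8 * k ^ 2 + 4 * k : K) • ((b * rel_sym_x_x_x) * b)
        + (48 * k ^ 3 : K) • (rel_sym_x_x_ooxycyc)
        + (24 * k ^ 4 - 84 * k ^ 3 - 12 * k ^ 2 : K) • (rel_sym_y_y_x * (a * a))
        + (-24 * k ^ 5 + 24 * k ^ 4 + 6 * k ^ 3 + 6 * k ^ 2 : K) • (rel_sym_y_y_x * p)
        + (6 * k ^ 3 + 6 * k ^ 2 : K) • (rel_op_y_y_x_x_x)
        + (-6 * k ^ 3 - 6 * k ^ 2 : K) • (rel_form_y_y_x_x * a)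
        + (12 * k ^ 3 + 12 * k ^ 2 : K) • (rel_sym_y_x_ooxxcyc)
        + (10 * k ^ 3 - 16 * k ^ 2 + 6 * k : K) • (rel_form_y_x_x_x * b)
        + (-6 * k ^ 4 + 6 * k ^ 2 : K) • (rV_oyyc_ooxxcxc)
        + (-24 * k ^ 5 + 108 * k ^ 4 - 72 * k ^ 3 - 12 * k ^ 2 : K) • ((a * rel_sym_y_y_x) * a)
        + (48 * k ^ 5 - 48 * k ^ 4 - 24 * k ^ 3 + 72 * k ^ 2 : K) • ((a * b) * rel_sym_y_x_x)
        + (24 * k ^ 4 - 12 * k ^ 3 - 24 * k ^ 2 + 12 * k : K) • (a * rel_sym_y_y_oxxc)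
        + (48 * k ^ 5 - 96 * k ^ 4 + 108 * k ^ 3 - 48 * k ^ 2 - 12 * k : K)
            • ((a * rel_sym_y_x_x) * b)
        + (24 * k ^ 4 - 24 * k ^ 2 : K) • (a * rel_sym_y_x_oxyc)
        + (-12 * k ^ 4 + 30 * k ^ 3 - 12 * k ^ 2 - 6 * k : K) • (a * rel_sym_x_x_oyyc)
        + (6 * k ^ 4 - 12 * k ^ 3 - 6 * k : K) • (a * rel_form_y_y_x_x)
        + (-24 * k ^ 5 + 84 * k ^ 4 - 156 * k ^ 3 + 48 * k ^ 2 + 24 * k : K)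
            • ((a * a) * rel_sym_y_y_x)
        + (4 * k ^ 3 + 2 * k ^ 2 + 6 * k : K) • (rel_form_x_x_y_x * b)
        + (36 * k ^ 3 - 18 * k ^ 2 - 6 * k : K) • (rel_sym_x_x_ooyycxc)
        + (-8 * k ^ 6 + 40 * k ^ 5 - 28 * k ^ 4 + 10 * k ^ 2 - 2 * k : K) • (rel_sym_x_x_x * r)
        + (-10 * k ^ 3 + 16 * k ^ 2 - 6 * k : K) • (rel_op_y_x_x_x_y)
        + (-4 * k ^ 3 - 2 * k ^ 2 - 6 * k : K) • (rel_op_x_x_y_x_y)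
        + (-12 * k ^ 4 + 12 * k ^ 3 + 6 * k ^ 2 - 18 * k : K) • (a * rel_form_x_x_y_y)
    have h24 : (24 : K) ≠ 0 := by
      rw [show (24 : K) = 2 * 2 * 2 * 3 by norm_num]; exact mul_ne_zero (mul_ne_zero (mul_ne_zero
          h2 h2) h2) h3
    refine (smul_eq_zero.1 h).resolve_left ?_
    exact mul_ne_zero (mul_ne_zero (mul_ne_zero h24 (pow_ne_zero _ hk0)) (pow_ne_zero _ hk1)) hk

end

/-! ### Skew-symmetry of long words -/

section Words

variable {K V G : Type*} [Field K] [AddCommGroup V] [Module K V]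

/-- Adjacent swaps bring two equal letters together at the cost of a sign, and then f = -f. The swap
rule is only required for words of length m and degree above a threshold, both preserved by swaps;
`e` is the degree of a part that stays fixed and is not listed in the word. -/
theorem eq_zero_of_not_nodup (h2 : (2 : K) ≠ 0) (deg : G → ℕ) (m B e : ℕ) (f : List G → V)
    (hf : ∀ u c d w, (u ++ c :: d :: w).length = m → B < ((u ++ c :: d :: w).map deg).sum + e →
      f (u ++ c :: d :: w) + f (u ++ d :: c :: w) = 0)
    (l : List G) (hl : l.length = m) (hB : B < (l.map deg).sum + e) (hn : ¬ l.Nodup) : f l = 0 := by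
  have key : ∀ (v u : List G) (a : G) (w : List G), (u ++ a :: (v ++ a :: w)).length = m →
      B < ((u ++ a :: (v ++ a :: w)).map deg).sum + e → f (u ++ a :: (v ++ a :: w)) = 0 := by
    intro v
    induction v with
    | nil =>
      intro u a w h1 h3
      have h := hf u a a w h1 h3
      rw [← two_smul K] at h
      exact (smul_eq_zero.1 h).resolve_left h2
    | cons b v ih =>
      intro u a w h1 h3
      have h := hf u a b (v ++ a :: w) h1 h3
      have h' := ih (u ++ [b]) a w (by simp at h1 ⊢; omega) (by simp at h3 ⊢; omega)
      simp only [List.append_assoc, List.cons_append, List.nil_append] at h h' ⊢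
      rwa [h', add_zero] at h
  have of_append : ∀ (l u : List G), ¬ l.Nodup → (u ++ l).length = m → B < ((u ++ l).map deg).sum + e →
      f (u ++ l) = 0 := by
    intro l
    induction l with
    | nil => intro u h; simp at h
    | cons a l ih =>
      intro u h h1 h3
      by_cases ha : a ∈ l
      · obtain ⟨v, w, rfl⟩ := List.append_of_mem ha
        exact key v u a w h1 h3
      · have hl : ¬ l.Nodup := fun hl => h (List.nodup_cons.2 ⟨ha, hl⟩)
        have := ih (u ++ [a]) hl (by simpa using h1) (by simpa using h3)
        simpa using this
  simpa using of_append l [] hn (by simpa using hl) (by simpa using hB)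

/-- A function on words in which the anticommutator of two letters commutes with the other
letters up to the factor `-k`, and which vanishes on the symmetrization of any three letters,
vanishes on words that are longer than the number of letters by three. -/
theorem eq_zero_of_anticommutator (h2 : (2 : K) ≠ 0) {k : K} (hk0 : k ≠ 0) (hk1 : k ≠ 1)
    (hk1' : k ≠ -1) (deg : G → ℕ) (m B : ℕ) (f : List G → V) (T : Finset G)
    (hT : ∀ l, (∃ p ∈ l, p ∉ T) → f l = 0) (hm : T.card + 3 ≤ m)
    (h1 : ∀ u a b c w, (u ++ a :: b :: c :: w).length = m →
      B < ((u ++ a :: b :: c :: w).map deg).sum →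
      f (u ++ a :: b :: c :: w) + f (u ++ b :: a :: c :: w)
        + k • (f (u ++ c :: a :: b :: w) + f (u ++ c :: b :: a :: w)) = 0)
    (h3 : ∀ u a b c w, (u ++ a :: b :: c :: w).length = m →
      B < ((u ++ a :: b :: c :: w).map deg).sum →
      f (u ++ a :: b :: c :: w) + f (u ++ a :: c :: b :: w) + f (u ++ b :: a :: c :: w)
        + f (u ++ b :: c :: a :: w) + f (u ++ c :: a :: b :: w) + f (u ++ c :: b :: a :: w) = 0)
    (l : List G) (hl : l.length = m) (hB : B < (l.map deg).sum) : f l = 0 := by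
  have dup : ∀ t : List G, T.card < t.length → (∃ p ∈ t, p ∉ T) ∨ ¬ t.Nodup := by
    intro t ht
    by_contra! h
    obtain ⟨hs, hn⟩ := h
    classical
    have : t.toFinset ⊆ T := fun p hp => hs p (List.mem_toFinset.1 hp)
    have := Finset.card_le_card this
    rw [List.toFinset_card_of_nodup hn] at this
    omega
  -- Two adjacent anticommutators annihilate a word. Write [a,c] for ac + ca. Symmetrization gives
  -- abc + cba = -(1-k) b[a,c]; applied to both triples in a word on a, b, c, d and combined with
  -- moving [a,c] to the right, it gives (1-k)k(k+1)[b,d][a,c] = 0.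
  have two_adj : ∀ u a c b d w, (u ++ a :: c :: b :: d :: w).length = m →
      B < ((u ++ a :: c :: b :: d :: w).map deg).sum →
      f (u ++ b :: d :: a :: c :: w) + f (u ++ d :: b :: a :: c :: w)
        + (f (u ++ b :: d :: c :: a :: w) + f (u ++ d :: b :: c :: a :: w)) = 0 := by
    intro u a c b d w hm' hB'
    have e1 := h1 u a c b (d :: w) (by simp at hm' ⊢; omega) (by simp at hB' ⊢; omega)
    have e2 := h1 u a c d (b :: w) (by simp at hm' ⊢; omega) (by simp at hB' ⊢; omega)
    have s1 := h3 u a b c (d :: w) (by simp at hm' ⊢; omega) (by simp at hB' ⊢; omega)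
    have s2 := h3 u a d c (b :: w) (by simp at hm' ⊢; omega) (by simp at hB' ⊢; omega)
    have f1 := h1 (u ++ [b]) a c d w (by simp at hm' ⊢; omega) (by simp at hB' ⊢; omega)
    have f2 := h1 (u ++ [d]) a c b w (by simp at hm' ⊢; omega) (by simp at hB' ⊢; omega)
    have g1 := h1 (u ++ [a]) b d c w (by simp at hm' ⊢; omega) (by simp at hB' ⊢; omega)
    have g2 := h1 (u ++ [c]) b d a w (by simp at hm' ⊢; omega) (by simp at hB' ⊢; omega)
    have t1 := h3 (u ++ [a]) b c d w (by simp at hm' ⊢; omega) (by simp at hB' ⊢; omega)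
    have t2 := h3 (u ++ [c]) b a d w (by simp at hm' ⊢; omega) (by simp at hB' ⊢; omega)
    simp only [List.append_assoc, List.cons_append, List.nil_append] at f1 f2 g1 g2 t1 t2
    have h : ((1 - k) * k * (k + 1)) • (f (u ++ b :: d :: a :: c :: w)
        + f (u ++ d :: b :: a :: c :: w)
        + (f (u ++ b :: d :: c :: a :: w) + f (u ++ d :: b :: c :: a :: w))) = 0 := by
      linear_combination (norm := module) (t1 + t2 - g1 - g2)
        - (1 - k) • ((e1 + e2) - k • (f1 + f2)) - ((s1 + s2 - e1 - e2) - (1 - k) • (f1 + f2))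
    refine (smul_eq_zero.1 h).resolve_left (mul_ne_zero (mul_ne_zero ?_ hk0) ?_)
    · exact fun h => hk1 (by linear_combination -h)
    · exact fun h => hk1' (by linear_combination h)
  -- Two anticommutators at any distance: the left one moves toward the right one, picking up a
  -- factor -k at each letter.
  have two : ∀ v u a b c d w, (u ++ a :: b :: (v ++ c :: d :: w)).length = m →
      B < ((u ++ a :: b :: (v ++ c :: d :: w)).map deg).sum →
      f (u ++ a :: b :: (v ++ c :: d :: w)) + f (u ++ b :: a :: (v ++ c :: d :: w))
        + (f (u ++ a :: b :: (v ++ d :: c :: w)) + f (u ++ b :: a :: (v ++ d :: c :: w))) = 0 := by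
    intro v
    induction v with
    | nil =>
      intro u a b c d w hm' hB'
      exact two_adj u c d a b w (by simp at hm' ⊢; omega) (by simp at hB' ⊢; omega)
    | cons e v ih =>
      intro u a b c d w hm' hB'
      have h := ih (u ++ [e]) a b c d w (by simp at hm' ⊢; omega) (by simp at hB' ⊢; omega)
      have e1 := h1 u a b e (v ++ c :: d :: w) (by simp at hm' ⊢; omega)
        (by simp at hB' ⊢; omega)
      have e2 := h1 u a b e (v ++ d :: c :: w) (by simp at hm' ⊢; omega)
        (by simp at hB' ⊢; omega)
      simp only [List.append_assoc, List.cons_append, List.nil_append] at h ⊢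
      linear_combination (norm := module) e1 + e2 - k • h
  -- With an anticommutator at the end, the remaining m - 2 letters may be swapped up to sign by
  -- `two`. They outnumber T, so one repeats or lies outside T.
  have last : ∀ a b t, (t ++ [a, b]).length = m → B < ((t ++ [a, b]).map deg).sum →
      f (t ++ [a, b]) + f (t ++ [b, a]) = 0 := by
    intro a b t hm' hB'
    rcases dup t (by simp at hm'; omega) with ⟨p, hp, hpT⟩ | hn
    · rw [hT _ ⟨p, by simp [hp], hpT⟩, hT _ ⟨p, by simp [hp], hpT⟩, add_zero]
    · refine eq_zero_of_not_nodup (f := fun t => f (t ++ [a, b]) + f (t ++ [b, a])) h2 deg (m - 2) B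
        (deg a + deg b) ?_ t (by simp at hm'; omega) (by simp at hB'; omega) hn
      intro u c d w h4 h5
      have h := two w u c d a b [] (by simp at h4 hm' ⊢; omega) (by simp at h5 ⊢; omega)
      simp only [List.append_assoc, List.cons_append]
      linear_combination (norm := module) h
  -- Any anticommutator can be pushed to the end of the word by factors -k, where `last` applies.
  have skew : ∀ w u a b, (u ++ a :: b :: w).length = m → B < ((u ++ a :: b :: w).map deg).sum →
      f (u ++ a :: b :: w) + f (u ++ b :: a :: w) = 0 := by
    intro w
    induction w with
    | nil => intro u a b hm' hB'; exact last a b u hm' hB'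
    | cons c w ih =>
      intro u a b hm' hB'
      have h := ih (u ++ [c]) a b (by simp at hm' ⊢; omega) (by simp at hB' ⊢; omega)
      have e1 := h1 u a b c w hm' hB'
      simp only [List.append_assoc, List.cons_append, List.nil_append] at h
      linear_combination (norm := module) e1 - k • h
  rcases dup l (by omega) with hp | hn
  · exact hT l hp
  · exact eq_zero_of_not_nodup h2 deg m B 0 f (fun u c d w h4 h5 => skew w u c d h4 h5) l hl hB hn

/-- Words of large degree in operators satisfying the identities of the left multiplications of a
commutative algebra with `L_x ^ 3 + γ L_{x ^ 3} = 0` on a bimodule killed by all cubes. -/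
theorem prod_map_eq_zero_of_anticommutator {R : Type*} [Ring R] [Algebra K R] [Mul G]
    (h2 : (2 : K) ≠ 0) {k : K} (hk0 : k ≠ 0) (hk1 : k ≠ 1) (hk1' : k ≠ -1) (deg : G → ℕ)
    (hdeg : ∀ a b, deg (a * b) = deg a + deg b) (ρ : G → R) (T : Finset G) (N : ℕ)
    (hT : ∀ p, p ∉ T → ρ p = 0) (hN : ∀ p ∈ T, deg p ≤ N)
    (h3 : ∀ a b c, ρ a * ρ b * ρ c + ρ a * ρ c * ρ b + ρ b * ρ a * ρ c + ρ b * ρ c * ρ a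
      + ρ c * ρ a * ρ b + ρ c * ρ b * ρ a = 0)
    (h1 : ∀ a b c, ρ (a * b * c) + ρ (a * b) * ρ c + ρ c * ρ (a * b)
      = (ρ (a * b) + ρ a * ρ b + ρ b * ρ a) * ρ c
        + k • (ρ c * (ρ (a * b) + ρ a * ρ b + ρ b * ρ a)))
    (l : List G) (hl : (T.card + 2) * N < (l.map deg).sum) : (l.map ρ).prod = 0 := by
  have hz : ∀ l : List G, (∃ p ∈ l, p ∉ T) → (l.map ρ).prod = 0 := by
    rintro l ⟨p, hp, hpT⟩
    exact List.prod_eq_zero (List.mem_map.2 ⟨p, hp, hT p hpT⟩)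
  induction hm : l.length using Nat.strong_induction_on generalizing l with
  | _ m ih =>
    by_cases hmT : T.card + 3 ≤ m
    · refine eq_zero_of_anticommutator h2 hk0 hk1 hk1' deg m ((T.card + 2) * N)
        (fun l => (l.map ρ).prod) T hz hmT ?_ ?_ l hm hl
      · intro u a b c w h4 h5
        -- Multiplying letters shortens the word but keeps its degree, so the induction hypothesis
        -- removes every term of `h1` containing a composite letter. Only the commutation rule for
        -- the anticommutator is left.
        have z1 := ih _ (by simp at h4 ⊢; omega) (u ++ a * b * c :: w)
          (by simp [hdeg] at h5 ⊢; omega) rfl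
        have z2 := ih _ (by simp at h4 ⊢; omega) (u ++ a * b :: c :: w)
          (by simp [hdeg] at h5 ⊢; omega) rfl
        have z3 := ih _ (by simp at h4 ⊢; omega) (u ++ c :: a * b :: w)
          (by simp [hdeg] at h5 ⊢; omega) rfl
        have h := congrArg (fun t => (u.map ρ).prod * t * (w.map ρ).prod) (h1 a b c)
        simp only [List.map_append, List.map_cons, List.prod_append, List.prod_cons, mul_add,
          add_mul, smul_mul_assoc, mul_smul_comm, mul_assoc, smul_add] at z1 z2 z3 h ⊢
        linear_combination (norm := module) z1 - k • z3 + z3 - h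
      · intro u a b c w _ _
        have h := congrArg (fun t => (u.map ρ).prod * t * (w.map ρ).prod) (h3 a b c)
        simpa only [List.map_append, List.map_cons, List.prod_append, List.prod_cons, mul_add,
          add_mul, mul_assoc, mul_zero, zero_mul] using h
    -- A word of at most |T| + 2 letters, all from T, has degree at most (|T| + 2) N, contrary to
    -- the assumption.
    · by_contra h0
      have hall : ∀ p ∈ l, p ∈ T := fun p hp => by
        by_contra hpT
        exact h0 (hz l ⟨p, hp, hpT⟩)
      have : (l.map deg).sum ≤ (l.map deg).length * N := by
        have := List.sum_le_card_nsmul (l.map deg) N (fun x hx => by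
          obtain ⟨p, hp, rfl⟩ := List.mem_map.1 hx
          exact hN p (hall p hp))
        simpa using this
      rw [List.length_map, hm] at this
      have : m * N ≤ (T.card + 2) * N := Nat.mul_le_mul_right _ (by omega)
      omega

end Words

/-! ### The ideal spanned by the cubes -/

section CubeSpan

variable {K : Type u} [Field K] {A : Type v} [NonUnitalNonAssocCommRing A] [Module K A]

variable (K A) in
/-- The subspace spanned by the cubes `x (x x)`. -/
def cubeSpan : Submodule K A := Submodule.span K (Set.range fun x : A => x * (x * x))

theorem cube_mem_cubeSpan (x : A) : x * (x * x) ∈ cubeSpan K A :=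
  Submodule.subset_span ⟨x, rfl⟩

theorem cubeForm_mem_cubeSpan (h2 : (2 : K) ≠ 0) (a b c : A) : cubeForm a b c ∈ cubeSpan K A := by
  have h : (2 : K) • cubeForm a b c = (a + b + c) * ((a + b + c) * (a + b + c))
      - (a + b) * ((a + b) * (a + b)) - (a + c) * ((a + c) * (a + c))
      - (b + c) * ((b + c) * (b + c)) + a * (a * a) + b * (b * b) + c * (c * c) := by
    simp only [cubeForm, two_smul, mul_add, add_mul, mul_comm c b, mul_comm c a, mul_comm b a]
    abel
  rw [← inv_smul_smul₀ h2 (cubeForm a b c), h]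
  exact Submodule.smul_mem _ _ (add_mem (add_mem (add_mem (sub_mem (sub_mem (sub_mem
    (cube_mem_cubeSpan _) (cube_mem_cubeSpan _)) (cube_mem_cubeSpan _)) (cube_mem_cubeSpan _))
    (cube_mem_cubeSpan _)) (cube_mem_cubeSpan _)) (cube_mem_cubeSpan _))

variable [IsScalarTower K A A] [SMulCommClass K A A] {γ : K}

namespace SatisfiesCubicIdentity

/-- By `cyclic`, x{x,x,a} = -a x³. Inserted into `cubeForm_mul` for {xx,x,a}, this turns the
correction term into 4γ a x³, which is therefore a difference of two values of `cubeForm`. -/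
theorem mul_mem_cubeSpan (hA : SatisfiesCubicIdentity K A γ) (h2 : (2 : K) ≠ 0)
    (h3 : (3 : K) ≠ 0) (hγ : γ ≠ -1) (hγ0 : γ ≠ 0) (a : A) {b : A} (hb : b ∈ cubeSpan K A) :
    a * b ∈ cubeSpan K A := by
  induction hb using Submodule.span_induction with
  | mem b hb =>
    obtain ⟨x, rfl⟩ := hb
    have e1 := hA.cubeForm_mul h2 hγ x x x a
    have e2 := hA.cyclic h2 hγ a x x x
    have e3 : cubeForm x x x = (3 : K) • (x * (x * x)) := by
      rw [cubeForm]; module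
    have e4 : x * cubeForm x x a = -(a * (x * (x * x))) := by
      have : (3 : K) • (x * cubeForm x x a + a * (x * (x * x))) = 0 := by
        rw [e3, mul_smul_comm] at e2
        linear_combination (norm := module) e2
      exact eq_neg_of_add_eq_zero_left ((smul_eq_zero.1 this).resolve_left h3)
    rw [e4, e3, mul_smul_comm] at e1
    have h : (2 * (2 * γ)) • (a * (x * (x * x)))
        = cubeForm (x * x) x a - cubeForm x x (x * a) := by
      linear_combination (norm := module) -e1
    change a * (x * (x * x)) ∈ cubeSpan K A
    rw [← inv_smul_smul₀ (mul_ne_zero h2 (mul_ne_zero h2 hγ0)) (a * (x * (x * x))), h]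
    exact Submodule.smul_mem _ _
      (sub_mem (cubeForm_mem_cubeSpan h2 _ _ _) (cubeForm_mem_cubeSpan h2 _ _ _))
  | zero => rw [mul_zero]; exact zero_mem _
  | add x y _ _ hx hy => rw [mul_add]; exact add_mem hx hy
  | smul t x _ hx => rw [mul_smul_comm]; exact Submodule.smul_mem _ _ hx

/-- Since Q_{y,y} y = 3y³, the identity L_x Q_{x,x} Q_{y,y} = 0 evaluated at y gives x{x,x,y³} = 0.
By `sum_mulLeft_mul_cubeOp` with all arguments equal to x, this is a nonzero multiple of x³ y³. -/
theorem mul_eq_zero_of_mem_cubeSpan (hA : SatisfiesCubicIdentity K A γ) (h2 : (2 : K) ≠ 0)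
    (h3 : (3 : K) ≠ 0) (hγ : γ ≠ -1) (hγ0 : γ ≠ 0) (hγ1 : γ ≠ 1 / 2) {a b : A}
    (ha : a ∈ cubeSpan K A) (hb : b ∈ cubeSpan K A) : a * b = 0 := by
  induction ha using Submodule.span_induction with
  | mem a ha =>
    obtain ⟨x, rfl⟩ := ha
    induction hb using Submodule.span_induction with
    | mem b hb =>
      obtain ⟨y, rfl⟩ := hb
      have e1 := congrArg (fun f => f y)
        (hA.mulLeft_mul_cubeOp_mul_cubeOp h2 h3 hγ hγ0 hγ1 x y)
      have e2 := congrArg (fun f => f (y * (y * y))) (hA.sum_mulLeft_mul_cubeOp h2 hγ x x x)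
      have e3 (z : A) : cubeForm z z z = (3 : K) • (z * (z * z)) := by
        rw [cubeForm]; module
      simp only [Module.End.mul_apply, cubeOp_apply, e3, map_smul, LinearMap.zero_apply,
        LinearMap.add_apply, LinearMap.neg_apply, mulLeft_apply, smul_mul_assoc] at e1 e2
      have e4 : x * cubeForm x x (y * (y * y)) = 0 := (smul_eq_zero.1 e1).resolve_left h3
      simp only [e4, add_zero] at e2
      exact (smul_eq_zero.1 (neg_eq_zero.1 e2.symm)).resolve_left h3
    | zero => exact mul_zero _
    | add x y _ _ hx hy => rw [mul_add, hx, hy, add_zero]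
    | smul t x _ hx => rw [mul_smul_comm, hx, smul_zero]
  | zero => exact zero_mul _
  | add x y _ _ hx hy => rw [add_mul, hx, hy, add_zero]
  | smul t x _ hx => rw [smul_mul_assoc, hx, smul_zero]

/-- Products of left multiplications of large total degree vanish on the span of the cubes. The
letters are the elements of a magma `G` with a degree, evaluated in the algebra. -/
theorem foldr_mul_eq_zero {G : Type*} [Mul G] (hA : SatisfiesCubicIdentity K A γ)
    (h2 : (2 : K) ≠ 0) (h3 : (3 : K) ≠ 0) (hγ : γ ≠ -1) (hγ0 : γ ≠ 0) (hγ1 : γ ≠ 1 / 2)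
    (hγ1' : γ ≠ -(1 / 2)) (deg : G → ℕ) (hdeg : ∀ a b, deg (a * b) = deg a + deg b)
    (ev : G →ₙ* A) (T : Finset G) (N : ℕ) (hT : ∀ p, p ∉ T → ev p ∈ cubeSpan K A)
    (hN : ∀ p ∈ T, deg p ≤ N) (l : List G) (hl : (T.card + 2) * N < (l.map deg).sum)
    {b : A} (hb : b ∈ cubeSpan K A) : l.foldr (fun p c => ev p * c) b = 0 := by
  have hmul (a : A) {b : A} := hA.mul_mem_cubeSpan h2 h3 hγ hγ0 a (b := b)
  have hzero {a b : A} := hA.mul_eq_zero_of_mem_cubeSpan (a := a) (b := b) h2 h3 hγ hγ0 hγ1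
  -- As I·I = 0, multiplication by {a,b,c} is zero on I; this kills the right sides of
  -- `sum_perm_mulLeft` and `sum_mulLeft_mul_cubeOp` there.
  have hcz (a b c : A) {d : A} (hd : d ∈ cubeSpan K A) : cubeForm a b c * d = 0 :=
    hzero (cubeForm_mem_cubeSpan h2 a b c) hd
  let ρ (p : G) : Module.End K (cubeSpan K A) :=
    (mulLeft K (ev p)).restrict fun _ hb => hmul _ hb
  have hρ (p : G) (c : cubeSpan K A) : (ρ p c : A) = ev p * c := rfl
  have key : (l.map ρ).prod = 0 := by
    refine prod_map_eq_zero_of_anticommutator h2 (k := 2 * γ) (mul_ne_zero h2 hγ0) ?_ ?_ deg hdeg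
      ρ T N ?_ hN ?_ ?_ l hl
    · exact fun h => hγ1 (by field_simp; linear_combination h)
    · exact fun h => hγ1' (by field_simp; linear_combination h)
    · intro p hp
      ext c
      exact hzero (hT p hp) c.2
    · intro a b c
      ext d
      have h := congrArg (fun f => f (d : A)) (hA.sum_perm_mulLeft (ev a) (ev b) (ev c))
      simp only [Module.End.mul_apply, LinearMap.add_apply, LinearMap.neg_apply,
        LinearMap.smul_apply, mulLeft_apply, hcz _ _ _ d.2, smul_zero, neg_zero] at h
      simp only [Module.End.mul_apply, LinearMap.add_apply, Submodule.coe_add, hρ,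
        LinearMap.zero_apply, Submodule.coe_zero]
      linear_combination (norm := abel) h
    -- On I the sum L_a Q_{b,c} + L_b Q_{a,c} + L_c Q_{a,b} vanishes, so `cubeOp_mul` becomes
    -- Q_{ab,c} = Q_{a,b} L_c + 2γ L_c Q_{a,b}.
    · intro a b c
      ext d
      have h := congrArg (fun f => f (d : A)) (hA.cubeOp_mul h2 hγ (ev a) (ev b) (ev c))
      have h' := congrArg (fun f => f (d : A))
        (hA.sum_mulLeft_mul_cubeOp h2 hγ (ev a) (ev b) (ev c))
      simp only [cubeOp, Module.End.mul_apply, LinearMap.add_apply, LinearMap.neg_apply,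
        LinearMap.sub_apply, LinearMap.smul_apply, mulLeft_apply, hcz _ _ _ d.2, neg_zero] at h h'
      simp only [Module.End.mul_apply, LinearMap.add_apply, Submodule.coe_add, hρ,
        LinearMap.smul_apply, Submodule.coe_smul, map_mul]
      linear_combination (norm := module) h - (2 * γ) • h'
  have fold (l : List G) (c : cubeSpan K A) :
      ((l.map ρ).prod c : A) = l.foldr (fun p c => ev p * c) c := by
    induction l with
    | nil => rfl
    | cons p l ih => rw [List.map_cons, List.prod_cons, Module.End.mul_apply, hρ, ih]; rfl
  have := fold l ⟨b, hb⟩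
  rw [key] at this
  exact this.symm

end SatisfiesCubicIdentity

end CubeSpan

/-! ### Bracketed products and nested multiplications -/

section Products

variable {A : Type v} [NonUnitalNonAssocRing A]

/-- A subproduct may be regarded as a single factor. Hence the vanishing of all products of n
factors extends to longer products. -/
theorem exists_length_eq_of_le_length (w : FreeMagma A) {j : ℕ} (hj : 1 ≤ j) (hw : j ≤ w.length) :
    ∃ w' : FreeMagma A, w'.length = j ∧
      FreeMagma.lift (id : A → A) w' = FreeMagma.lift (id : A → A) w := by
  induction w using FreeMagma.recOnMul generalizing j with
  | ih1 a => exact ⟨.of a, le_antisymm hj hw, rfl⟩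
  | ih2 x y hx hy =>
    rcases hj.eq_or_lt with rfl | hj
    · exact ⟨.of (FreeMagma.lift id (x * y)), rfl, rfl⟩
    · have hw : j ≤ x.length + y.length := hw
      have := x.length_pos
      have := y.length_pos
      obtain ⟨j₁, j₂, h1, h2, h3, h4, rfl⟩ : ∃ j₁ j₂, 1 ≤ j₁ ∧ j₁ ≤ x.length ∧ 1 ≤ j₂ ∧
          j₂ ≤ y.length ∧ j = j₁ + j₂ := by
        rcases le_or_gt (j - 1) x.length with h | h
        · exact ⟨j - 1, 1, by omega⟩
        · exact ⟨x.length, j - x.length, by omega⟩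
      obtain ⟨x', hx1, hx2⟩ := hx h1 h2
      obtain ⟨y', hy1, hy2⟩ := hy h3 h4
      refine ⟨x' * y', ?_, by rw [map_mul, map_mul, hx2, hy2]⟩
      rw [← hx1, ← hy1]; rfl

theorem ProductsVanish.lift_eq_zero {n : ℕ} (h : ProductsVanish A n) (hn : 1 ≤ n)
    (w : FreeMagma A) (hw : n ≤ w.length) : FreeMagma.lift (id : A → A) w = 0 := by
  obtain ⟨w', h1, h2⟩ := exists_length_eq_of_le_length w hn hw
  rw [← h2, h w' h1]

theorem exists_hasNilpotencyIndex_le {N : ℕ} (hN : 0 < N) (h : ProductsVanish A N) :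
    ∃ m, HasNilpotencyIndex A m ∧ m ≤ N := by
  classical
  have hex : ∃ m : ℕ, 0 < m ∧ ProductsVanish A m := ⟨N, hN, h⟩
  exact ⟨Nat.find hex, ⟨Nat.find_spec hex, fun m hm => Nat.find_min' hex hm⟩,
    Nat.find_min' hex ⟨hN, h⟩⟩

/-- In a commutative algebra a product of at least `2 ^ m` factors is obtained from some element
by `m` multiplications. -/
theorem exists_foldr_eq_of_two_pow_le_length {A : Type v} [NonUnitalNonAssocCommRing A]
    (m : ℕ) (w : FreeMagma A) (hw : 2 ^ m ≤ w.length) :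
    ∃ (l : List A) (b : A), l.length = m ∧
      FreeMagma.lift (id : A → A) w = l.foldr (· * ·) b := by
  induction m generalizing w with
  | zero => exact ⟨[], _, rfl, rfl⟩
  | succ m ih =>
    induction w using FreeMagma.recOnMul with
    | ih1 a =>
      have h : 2 ^ (m + 1) ≤ 1 := hw
      have : 1 < 2 ^ (m + 1) := Nat.one_lt_two_pow (Nat.succ_ne_zero m)
      omega
    | ih2 x y _ _ =>
      have hw : 2 ^ (m + 1) ≤ x.length + y.length := hw
      rw [map_mul]
      -- One of the two factors has at least 2^m letters; by commutativity the other one can be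
      -- taken as the outermost multiplier.
      rcases le_or_gt (2 ^ m) y.length with h | h
      · obtain ⟨l, b, h1, h2⟩ := ih y h
        exact ⟨FreeMagma.lift id x :: l, b, by simp [h1], by rw [h2]; rfl⟩
      · obtain ⟨l, b, h1, h2⟩ := ih x (by rw [pow_succ] at hw; omega)
        exact ⟨FreeMagma.lift id y :: l, b, by simp [h1], by rw [h2, mul_comm]; rfl⟩

theorem productsVanish_two_pow {A : Type v} [NonUnitalNonAssocCommRing A] {m : ℕ}
    (h : ∀ (l : List A) (b : A), l.length = m → l.foldr (· * ·) b = 0) {e : ℕ} (he : m ≤ e) :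
    ProductsVanish A (2 ^ e) := by
  intro w hw
  obtain ⟨l, b, h1, h2⟩ := exists_foldr_eq_of_two_pow_le_length m w
    (by rw [hw]; exact Nat.pow_le_pow_right (by norm_num) he)
  rw [h2, h l b h1]

/-- A multilinear expression in the factors of a product vanishes if it does so on a spanning
set. -/
theorem foldr_mul_eq_zero_of_span {K : Type u} [Field K] [Module K A] [IsScalarTower K A A]
    [SMulCommClass K A A] {G : Type*} (ev : G → A) (hev : Submodule.span K (Set.range ev) = ⊤)
    (m : ℕ) (h : ∀ (l : List G) (p : G), l.length = m → l.foldr (fun p c => ev p * c) (ev p) = 0)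
    (l : List A) (b : A) (hl : l.length = m) : l.foldr (· * ·) b = 0 := by
  have hev (a : A) : a ∈ Submodule.span K (Set.range ev) := by rw [hev]; trivial
  have hf (l : List G) (b : A) :
      l.foldr (fun p c => ev p * c) b = (l.map fun p => mulLeft K (ev p)).prod b := by
    induction l with
    | nil => rfl
    | cons p l ih => rw [List.map_cons, List.prod_cons, Module.End.mul_apply, List.foldr_cons, ih]
                     rfl
  -- The multipliers are replaced by spanning elements one at a time from the outside in; `u` holds
  -- those already replaced.
  have key (l : List A) (u : List G) (hm : u.length + l.length = m) :
      u.foldr (fun p c => ev p * c) (l.foldr (· * ·) b) = 0 := by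
    induction l generalizing u with
    | nil =>
      rw [List.foldr_nil, hf]
      induction hev b using Submodule.span_induction with
      | mem b hb => obtain ⟨p, rfl⟩ := hb; rw [← hf]; exact h u p hm
      | zero => exact map_zero _
      | add x y _ _ hx hy => rw [map_add, hx, hy, add_zero]
      | smul t x _ hx => rw [map_smul, hx, smul_zero]
    | cons a l ih =>
      rw [List.foldr_cons]
      replace hm : u.length + (l.length + 1) = m := hm
      induction hev a using Submodule.span_induction with
      | mem a ha =>
        obtain ⟨p, rfl⟩ := ha
        have := ih (u ++ [p]) (by simp at hm ⊢; omega)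
        simpa using this
      | zero => rw [zero_mul, hf, map_zero]
      | add x y _ _ hx hy =>
        rw [hf] at hx hy ⊢
        rw [add_mul, map_add, hx, hy, add_zero]
      | smul t x _ hx =>
        rw [hf] at hx ⊢
        rw [smul_mul_assoc, map_smul, hx, smul_zero]
  exact key l [] (by simpa using hl)

end Products

/-! ### Commutative monomials and the free algebras -/

section Monomials

variable {X : Type u}

theorem FreeMagma.finite_length_lt {X : Type u} [Finite X] (n : ℕ) :
    {w : FreeMagma X | w.length < n}.Finite := by
  induction n with
  | zero => simp
  | succ n ih =>
    refine ((Set.finite_range (FreeMagma.of (α := X))).union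
      (Set.Finite.image2 (· * ·) ih ih)).subset ?_
    intro w hw
    induction w using FreeMagma.recOnMul with
    | ih1 x => exact Or.inl ⟨x, rfl⟩
    | ih2 x y _ _ =>
      have hw : x.length + y.length < n + 1 := hw
      have := x.length_pos
      have := y.length_pos
      exact Or.inr ⟨x, (by omega : x.length < n), y, (by omega : y.length < n), rfl⟩

namespace CommMonomial

/-- The monomial of degree one given by a letter. -/
def of (x : X) : CommMonomial X := (FreeMagma.of x : FreeMagma X)

theorem degree_of (x : X) : (of x).degree = 1 := rfl

theorem degree_mul (p q : CommMonomial X) : (p * q).degree = p.degree + q.degree := by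
  induction p, q using Con.induction_on₂ with
  | H a b => rfl

theorem degree_pos (p : CommMonomial X) : 0 < p.degree := by
  induction p using Con.induction_on with
  | H a => exact a.length_pos

/-- The value of a commutative monomial in a commutative magma. -/
def lift {M : Type*} [CommMagma M] (g : X → M) : CommMonomial X →ₙ* M where
  toFun p := Con.liftOn p (FreeMagma.lift g) fun a b h => by
    change ConGen.Rel (fun p q => ∃ a b : FreeMagma X, p = a * b ∧ q = b * a) a b at h
    induction h with
    | of p q hpq =>
      obtain ⟨a, b, rfl, rfl⟩ := hpq
      rw [map_mul, map_mul, mul_comm]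
    | refl => rfl
    | symm h ih => exact ih.symm
    | trans h1 h2 ih1 ih2 => exact ih1.trans ih2
    | mul h1 h2 ih1 ih2 => rw [map_mul, map_mul, ih1, ih2]
  map_mul' p q := by
    induction p, q using Con.induction_on₂ with
    | H a b => exact map_mul (FreeMagma.lift g) a b

theorem finite_degree_lt [Finite X] (n : ℕ) : {p : CommMonomial X | p.degree < n}.Finite := by
  refine ((FreeMagma.finite_length_lt n).image fun w : FreeMagma X => (w : CommMonomial X)).subset ?_
  intro p hp
  induction p using Con.induction_on with
  | H a => exact ⟨a, hp, rfl⟩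

/-- The monomials of degree less than `n`. -/
noncomputable def below (X : Type u) [Finite X] (n : ℕ) : Finset (CommMonomial X) :=
  (finite_degree_lt n).toFinset

theorem mem_below [Finite X] {n : ℕ} {p : CommMonomial X} : p ∈ below X n ↔ p.degree < n := by
  simp [below]

end CommMonomial

/-- Distinct monomials are linearly independent. It is this count that enters the pigeonhole
argument, as the number of letters acting nontrivially on I. -/
theorem dimBelow_eq_card (K : Type u) [Field K] (n k : ℕ) :
    dimBelow K n k = (CommMonomial.below (Fin k) n).card := by
  have hli : LinearIndependent K
      (fun p : CommMonomial.below (Fin k) n => (MonoidAlgebra.single p.1 1 : FreeCommAlg K (Fin k))) := by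
    have h1 := (Finsupp.linearIndependent_single_one K (CommMonomial (Fin k))).comp
      (fun p : CommMonomial.below (Fin k) n => p.1) Subtype.val_injective
    let c : FreeCommAlg K (Fin k) →ₗ[K] (CommMonomial (Fin k) →₀ K) :=
      { toFun := MonoidAlgebra.coeff
        map_add' := MonoidAlgebra.coeff_add
        map_smul' := MonoidAlgebra.coeff_smul }
    exact LinearIndependent.of_comp c h1
  rw [dimBelow, ← Fintype.card_coe, ← finrank_span_eq_card hli]
  refine congrArg (fun s => Module.finrank K (Submodule.span K s)) (Set.ext fun f => ?_)
  constructor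
  · rintro ⟨p, hp, rfl⟩
    exact ⟨⟨p, CommMonomial.mem_below.2 hp⟩, rfl⟩
  · rintro ⟨p, rfl⟩
    exact ⟨p.1, CommMonomial.mem_below.1 p.2, rfl⟩

variable {K : Type v} [Field K]

theorem cube_mem_cubeIdeal (a : FreeCommAlg K X) : a * (a * a) ∈ cubeIdeal K X := by
  rw [cubeIdeal, Submodule.mem_sInf]
  exact fun N hN => hN.1 a

theorem cubeIdeal_le {N : Submodule K (FreeCommAlg K X)} (h1 : ∀ a, a * (a * a) ∈ N)
    (h2 : ∀ a, ∀ b ∈ N, a * b ∈ N) : cubeIdeal K X ≤ N :=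
  sInf_le ⟨h1, h2⟩

theorem coeff_mul_of (a b : FreeCommAlg K X) (x : X) :
    (a * b).coeff (CommMonomial.of x) = 0 := by
  induction a using MonoidAlgebra.induction_linear with
  | zero => simp
  | add f g hf hg => rw [add_mul, MonoidAlgebra.coeff_add, Finsupp.add_apply, hf, hg, add_zero]
  | single m r =>
    induction b using MonoidAlgebra.induction_linear with
    | zero => simp
    | add f g hf hg => rw [mul_add, MonoidAlgebra.coeff_add, Finsupp.add_apply, hf, hg, add_zero]
    | single n s =>
      classical
      rw [MonoidAlgebra.single_mul_single, MonoidAlgebra.coeff_single, Finsupp.single_apply, if_neg]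
      intro h
      have := congrArg CommMonomial.degree h
      rw [CommMonomial.degree_mul, CommMonomial.degree_of] at this
      have := m.degree_pos
      have := n.degree_pos
      omega

/-- The elements with coefficient zero at the letter x form a subspace containing every product,
because products have degree at least 2. It is thus an ideal containing all cubes, but not x. -/
theorem single_of_notMem_cubeIdeal (x : X) :
    (MonoidAlgebra.single (CommMonomial.of x) 1 : FreeCommAlg K X) ∉ cubeIdeal K X := by
  intro h
  let N : Submodule K (FreeCommAlg K X) :=
    { carrier := {f | f.coeff (CommMonomial.of x) = 0}
      zero_mem' := by simp
      add_mem' := fun {a b} ha hb => by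
        change _ = _ at ha hb ⊢
        rw [MonoidAlgebra.coeff_add, Finsupp.add_apply, ha, hb, add_zero]
      smul_mem' := fun t a ha => by
        change _ = _ at ha ⊢
        rw [MonoidAlgebra.coeff_smul_apply, ha, smul_zero] }
  have h1 : cubeIdeal K X ≤ N := cubeIdeal_le (fun a => coeff_mul_of _ _ x)
    (fun a b _ => coeff_mul_of _ _ x)
  have h2 : (MonoidAlgebra.single (CommMonomial.of x) 1 : FreeCommAlg K X).coeff
    (CommMonomial.of x) = 0 := h1 h
  classical
  rw [MonoidAlgebra.coeff_single, Finsupp.single_apply, if_pos rfl] at h2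
  exact one_ne_zero h2

namespace FreeCubeZeroAlg

theorem mk_mul (a b : FreeCommAlg K X) :
    (Submodule.Quotient.mk (a * b) : FreeCubeZeroAlg K X)
      = Submodule.Quotient.mk a * Submodule.Quotient.mk b := rfl

variable (K) in
/-- The generators of the free algebra with `x ^ 3 = 0`. -/
noncomputable def gen (x : X) : FreeCubeZeroAlg K X :=
  Submodule.Quotient.mk (MonoidAlgebra.single (CommMonomial.of x) 1)

theorem lift_gen (w : FreeMagma X) :
    FreeMagma.lift (gen K) w
      = Submodule.Quotient.mk (MonoidAlgebra.single (w : CommMonomial X) 1) := by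
  induction w using FreeMagma.recOnMul with
  | ih1 x => rfl
  | ih2 x y hx hy =>
    rw [map_mul, hx, hy, ← mk_mul, MonoidAlgebra.single_mul_single, mul_one]; rfl

theorem gen_ne_zero (x : X) : gen K x ≠ 0 := fun h =>
  single_of_notMem_cubeIdeal x ((Submodule.Quotient.mk_eq_zero _).1 h)

end FreeCubeZeroAlg

theorem length_map {α β : Type*} (f : α → β) (w : FreeMagma α) :
    (FreeMagma.map f w).length = w.length := by
  induction w using FreeMagma.recOnMul with
  | ih1 x => rfl
  | ih2 x y hx hy => rw [map_mul]; exact congrArg₂ (· + ·) hx hy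

theorem lift_id_map {α β : Type*} [Mul β] (f : α → β) (w : FreeMagma α) :
    FreeMagma.lift (_root_.id : β → β) (FreeMagma.map f w) = FreeMagma.lift f w := by
  induction w using FreeMagma.recOnMul with
  | ih1 x => rfl
  | ih2 x y hx hy => rw [map_mul, map_mul, map_mul, hx, hy]

theorem single_mem_cubeIdeal {n : ℕ} (h : ProductsVanish (FreeCubeZeroAlg K X) n) (hn : 1 ≤ n)
    (p : CommMonomial X) (hp : n ≤ p.degree) :
    (MonoidAlgebra.single p 1 : FreeCommAlg K X) ∈ cubeIdeal K X := by
  induction p using Con.induction_on with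
  | H w =>
    rw [← Submodule.Quotient.mk_eq_zero, ← FreeCubeZeroAlg.lift_gen,
      ← lift_id_map]
    exact h.lift_eq_zero hn _ (by rw [length_map]; exact hp)

/-- Index 1 would force the generators to be zero in the quotient. -/
theorem HasNilpotencyIndex.two_le {n : ℕ} (h : HasNilpotencyIndex (FreeCubeZeroAlg K X) n)
    (x : X) : 2 ≤ n := by
  obtain ⟨⟨hn, hv⟩, -⟩ := h
  by_contra hlt
  obtain rfl : n = 1 := by omega
  exact FreeCubeZeroAlg.gen_ne_zero x (hv (.of (FreeCubeZeroAlg.gen K x)) rfl)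

end Monomials

/-! ### The bound for the index of nilpotency -/

section Bound

variable {K : Type u} [Field K] {A : Type v} [NonUnitalNonAssocCommRing A] [Module K A]
  [IsScalarTower K A A] [SMulCommClass K A A] {γ : K}

/-- The preimage of I under the evaluation map is an ideal of the free algebra containing all cubes.
This expresses that A modulo I satisfies x³ = 0 without forming the quotient. -/
theorem lift_mem_cubeSpan (hI : ∀ a : A, ∀ b ∈ cubeSpan K A, a * b ∈ cubeSpan K A)
    {X : Type*} (g : X → A) {f : FreeCommAlg K X} (hf : f ∈ cubeIdeal K X) :
    MonoidAlgebra.liftMagma K (CommMonomial.lift g) f ∈ cubeSpan K A := by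
  set φ := MonoidAlgebra.liftMagma K (CommMonomial.lift g)
  have h : cubeIdeal K X ≤ (cubeSpan K A).comap (φ : FreeCommAlg K X →ₗ[K] A) := by
    refine cubeIdeal_le (fun a => ?_) (fun a b hb => ?_)
    · change φ (a * (a * a)) ∈ cubeSpan K A
      rw [map_mul, map_mul]
      exact cube_mem_cubeSpan _
    · change φ (a * b) ∈ cubeSpan K A
      rw [map_mul]
      exact hI _ _ hb
  exact h hf

theorem span_range_lift_eq_top {X : Type*} (g : X → A)
    (hg : NonUnitalAlgebra.adjoin K (Set.range g) = ⊤) :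
    Submodule.span K (Set.range (CommMonomial.lift g)) = ⊤ := by
  rw [eq_top_iff]
  rintro a -
  have ha : a ∈ NonUnitalAlgebra.adjoin K (Set.range g) := by rw [hg]; trivial
  induction ha using NonUnitalAlgebra.adjoin_induction with
  | mem x hx =>
    obtain ⟨x, rfl⟩ := hx
    exact Submodule.subset_span ⟨CommMonomial.of x, rfl⟩
  | add x y _ _ hx hy => exact add_mem hx hy
  | zero => exact zero_mem _
  | smul r x _ hx => exact Submodule.smul_mem _ _ hx
  | mul x y hx' hy' hx hy =>
    clear hx' hy'
    induction hx using Submodule.span_induction with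
    | mem x hx =>
      obtain ⟨p, rfl⟩ := hx
      induction hy using Submodule.span_induction with
      | mem y hy =>
        obtain ⟨q, rfl⟩ := hy
        exact Submodule.subset_span ⟨p * q, map_mul _ _ _⟩
      | zero => rw [mul_zero]; exact zero_mem _
      | add x y _ _ hx hy => rw [mul_add]; exact add_mem hx hy
      | smul t x _ hx => rw [mul_smul_comm]; exact Submodule.smul_mem _ _ hx
    | zero => rw [zero_mul]; exact zero_mem _
    | add x y _ _ hx hy => rw [add_mul]; exact add_mem hx hy
    | smul t x _ hx => rw [smul_mul_assoc]; exact Submodule.smul_mem _ _ hx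

theorem SatisfiesCubicIdentity.exists_hasNilpotencyIndex_le
    (hA : SatisfiesCubicIdentity K A γ) (h2 : (2 : K) ≠ 0)
    (h3 : (3 : K) ≠ 0) (hγ : γ ≠ -1) (hγ0 : γ ≠ 0) (hγ1 : γ ≠ 1 / 2) (hγ1' : γ ≠ -(1 / 2))
    {k : ℕ} (hk : 1 ≤ k) {n : ℕ} (hn : HasNilpotencyIndex (FreeCubeZeroAlg K (Fin k)) n)
    (hg : IsGeneratedBy K A k) :
    ∃ m : ℕ, HasNilpotencyIndex A m ∧ m ≤ 2 ^ (4 * n * dimBelow K n k + 2 * (n - 2)) := by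
  obtain ⟨g, hg⟩ := hg
  have hn2 := hn.two_le ⟨0, hk⟩
  set d := dimBelow K n k with hd
  have hd' : d = (CommMonomial.below (Fin k) n).card := dimBelow_eq_card K n k
  have hd1 : 1 ≤ d := by
    rw [hd', Nat.one_le_iff_ne_zero, Finset.card_ne_zero]
    exact ⟨CommMonomial.of ⟨0, hk⟩, CommMonomial.mem_below.2 hn2⟩
  let ev : CommMonomial (Fin k) →ₙ* A := CommMonomial.lift g
  have hev (p : CommMonomial (Fin k)) (hp : n ≤ p.degree) : ev p ∈ cubeSpan K A := by
    have h := lift_mem_cubeSpan (fun a b hb => hA.mul_mem_cubeSpan h2 h3 hγ hγ0 a hb) g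
      (single_mem_cubeIdeal hn.1.2 hn.1.1 p hp)
    simpa [ev] using h
  refine _root_.exists_hasNilpotencyIndex_le (by positivity)
    -- The n - 1 inner multiplications produce a monomial of degree at least n, hence an element of
    -- I. The (d + 2)(n - 1) + 1 outer ones have total degree large enough to annihilate I.
    (productsVanish_two_pow (m := ((d + 2) * (n - 1) + 1) + (n - 1)) ?_ ?_)
  · refine foldr_mul_eq_zero_of_span ev (span_range_lift_eq_top g hg) _ fun l p hl => ?_
    obtain ⟨l₁, l₂, rfl, h₁, h₂⟩ : ∃ l₁ l₂, l = l₁ ++ l₂ ∧ l₁.length = (d + 2) * (n - 1) + 1 ∧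
        l₂.length = n - 1 :=
      ⟨l.take ((d + 2) * (n - 1) + 1), l.drop ((d + 2) * (n - 1) + 1),
        (List.take_append_drop _ _).symm, by simp; omega, by simp; omega⟩
    rw [List.foldr_append]
    have hfold (l : List (CommMonomial (Fin k))) : ∃ q : CommMonomial (Fin k),
        l.foldr (fun p c => ev p * c) (ev p) = ev q ∧ l.length + 1 ≤ q.degree := by
      induction l with
      | nil => exact ⟨p, rfl, p.degree_pos⟩
      | cons r l ih =>
        obtain ⟨q, hq, hq'⟩ := ih
        refine ⟨r * q, by rw [List.foldr_cons, hq, map_mul], ?_⟩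
        have := r.degree_pos
        rw [CommMonomial.degree_mul, List.length_cons]
        omega
    obtain ⟨q, hq, hq'⟩ := hfold l₂
    rw [hq]
    refine hA.foldr_mul_eq_zero h2 h3 hγ hγ0 hγ1 hγ1' CommMonomial.degree CommMonomial.degree_mul
      ev (CommMonomial.below (Fin k) n) (n - 1) (fun p hp => ?_) (fun p hp => ?_) l₁ ?_
      (hev q (by omega))
    · exact hev p (by rwa [CommMonomial.mem_below, not_lt] at hp)
    · have := CommMonomial.mem_below.1 hp
      omega
    · rw [← hd']
      have : (l₁.map CommMonomial.degree).length ≤ (l₁.map CommMonomial.degree).sum :=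
        List.length_le_sum_of_one_le _ fun i hi => by
          obtain ⟨p, -, rfl⟩ := List.mem_map.1 hi
          exact p.degree_pos
      rw [List.length_map] at this
      omega
  -- For n ≥ 2 and d ≥ 1 one has (d + 3)(n - 1) + 1 ≤ 4nd + 2(n - 2).
  · obtain ⟨N, rfl⟩ := Nat.exists_eq_add_of_le hn2
    obtain ⟨D, hD⟩ := Nat.exists_eq_add_of_le hd1
    rw [hD, show 2 + N - 1 = N + 1 by omega, show 2 + N - 2 = N by omega]
    nlinarith [Nat.zero_le (D * N)]

end Bound

/-! ### Nilpotency of an associative algebra of multiplications -/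

section Anticommuting

theorem sum_map_zip_add {G : Type*} (deg : G → ℕ) (u : List G) (e : List ℕ) (h : u.length = e.length) :
    ((u.zip e).map fun a => deg a.1 + a.2).sum = (u.map deg).sum + e.sum := by
  induction u generalizing e with
  | nil => cases e with
    | nil => rfl
    | cons a e => simp at h
  | cons c u ih => cases e with
    | nil => simp at h
    | cons a e =>
      have := ih e (by simpa using h)
      simp only [List.zip_cons_cons, List.map_cons, List.sum_cons] at this ⊢
      omega

variable {K G R : Type*} [Field K] [Mul G] [Ring R] [Algebra K R]

/-- Long words in a nilpotent element `x` and in the values of the letters of `T` vanish if any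
two letters separated by a power of `x` anticommute up to words with fewer letters. -/
theorem pow_mul_prod_eq_zero (h2 : (2 : K) ≠ 0) (deg : G → ℕ)
    (hdeg : ∀ a b, deg (a * b) = deg a + deg b) (ev : G → R) (T : Finset G) (N : ℕ)
    (hT : ∀ p, p ∉ T → ev p = 0) (hN : ∀ p ∈ T, deg p ≤ N) (x : R) (hx : x ^ 3 = 0) (c : ℕ → K)
    (hswap : ∀ i p q, ev p * x ^ i * ev q + ev q * x ^ i * ev p
      = c i • (x ^ i * ev (p * q) + ev (p * q) * x ^ i))
    (i : ℕ) (l : List (G × ℕ))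
    (hl : 2 * (T.card + 1) + T.card * N < i + (l.map fun a => deg a.1 + a.2).sum) :
    x ^ i * (l.map fun a => ev a.1 * x ^ a.2).prod = 0 := by
  -- A power of x on the right merges into the last exponent, or into the initial one if there are
  -- no letters, so the word keeps its shape.
  have absorb (i j : ℕ) (u : List (G × ℕ)) : ∃ (i' : ℕ) (u' : List (G × ℕ)),
      u'.length = u.length ∧ i' + (u'.map fun a => deg a.1 + a.2).sum
        = i + (u.map fun a => deg a.1 + a.2).sum + j ∧
      x ^ i' * (u'.map fun a => ev a.1 * x ^ a.2).prod
        = x ^ i * (u.map fun a => ev a.1 * x ^ a.2).prod * x ^ j := by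
    rcases List.eq_nil_or_concat u with rfl | ⟨u, ⟨r, e⟩, rfl⟩
    · exact ⟨i + j, [], rfl, by simp, by simp [pow_add]⟩
    · exact ⟨i, u ++ [(r, e + j)], by simp, by simp; omega, by simp [pow_add, mul_assoc]⟩
  have hpow {i : ℕ} (hi : 3 ≤ i) : x ^ i = 0 := pow_eq_zero_of_le hi hx
  induction hm : l.length using Nat.strong_induction_on generalizing i l with
  | _ m ih =>
    by_contra h0
    have hi : i ≤ 2 := by
      by_contra hi
      exact h0 (by rw [hpow (by omega), zero_mul])
    have hle (a : G × ℕ) (ha : a ∈ l) : a.2 ≤ 2 := by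
      by_contra hi
      exact h0 (by rw [List.prod_eq_zero (List.mem_map.2 ⟨a, ha, by
        rw [hpow (by omega), mul_zero]⟩), mul_zero])
    have hmem (a : G × ℕ) (ha : a ∈ l) : a.1 ∈ T := by
      by_contra hi
      exact h0 (by rw [List.prod_eq_zero (List.mem_map.2 ⟨a, ha, by
        rw [hT _ hi, zero_mul]⟩), mul_zero])
    -- All exponents are at most 2. With at most |T| letters the degree is at most 2 + |T|(N + 2),
    -- which is the bound in `hl`; with more letters one of them repeats.
    rcases le_or_gt m T.card with hmT | hmT
    · have : (l.map fun a => deg a.1 + a.2).sum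
          ≤ (l.map fun a => deg a.1 + a.2).length * (N + 2) := by
        have := List.sum_le_card_nsmul (l.map fun a => deg a.1 + a.2) (N + 2) (fun n hn => by
          obtain ⟨a, ha, rfl⟩ := List.mem_map.1 hn
          exact Nat.add_le_add (hN _ (hmem a ha)) (hle a ha))
        simpa using this
      rw [List.length_map, hm] at this
      have : m * (N + 2) ≤ T.card * (N + 2) := Nat.mul_le_mul_right _ hmT
      rw [mul_add T.card] at this
      omega
    · refine h0 ?_
      obtain ⟨ps, es, hlen, rfl⟩ : ∃ (ps : List G) (es : List ℕ), ps.length = es.length ∧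
          l = ps.zip es := ⟨l.map Prod.fst, l.map Prod.snd, by simp, by
            rw [← List.unzip_fst, ← List.unzip_snd, List.zip_unzip]⟩
      have hps : ps.length = m := by rw [← hm, List.length_zip, ← hlen, min_self]
      have hn : ¬ ps.Nodup := fun hn => by
        classical
        have : ps.toFinset ⊆ T := fun p hp => by
          obtain ⟨j, hj, rfl⟩ := List.mem_iff_getElem.1 (List.mem_toFinset.1 hp)
          have : (ps[j], es[j]'(hlen ▸ hj)) ∈ ps.zip es :=
            List.mem_iff_getElem.2 ⟨j, by simpa [← hlen] using hj, by simp⟩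
          exact hmem _ this
        have := Finset.card_le_card this
        rw [List.toFinset_card_of_nodup hn] at this
        omega
      rw [sum_map_zip_add deg ps es hlen] at hl
      -- Only the letters are permuted; the exponents of x stay in their places and contribute the
      -- fixed degree `i + es.sum`.
      refine eq_zero_of_not_nodup
        (f := fun ps => x ^ i * ((ps.zip es).map fun a => ev a.1 * x ^ a.2).prod) h2 deg m
        (2 * (T.card + 1) + T.card * N) (i + es.sum) ?_ ps hps (by omega) hn
      intro u p q w h1 h3
      obtain ⟨e₁, r, rfl, he₁⟩ : ∃ e₁ r, es = e₁ ++ r ∧ e₁.length = u.length :=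
        ⟨es.take u.length, es.drop u.length, (List.take_append_drop _ _).symm, by
          rw [List.length_take, ← hlen, hps, ← h1, List.length_append]; omega⟩
      rw [hps, List.length_append, he₁] at hlen
      rw [List.length_append] at h1
      match r with
      | [] => simp at h1 hlen; omega
      | [a] => simp at h1 hlen; omega
      | a :: b :: e₂ =>
      have hw : w.length = e₂.length := by simp at h1 hlen; omega
      have hsum : ((u.zip e₁).map fun a => deg a.1 + a.2).sum
          + ((w.zip e₂).map fun a => deg a.1 + a.2).sum + deg p + deg q + i + a + b
          = ((u ++ p :: q :: w).map deg).sum + (i + (e₁ ++ a :: b :: e₂).sum) := by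
        rw [sum_map_zip_add deg u e₁ he₁.symm, sum_map_zip_add deg w e₂ hw]
        simp
        omega
      have hlz : (u.zip e₁).length = u.length := by rw [List.length_zip, he₁, min_self]
      have hlz' : (w.zip e₂).length = w.length := by rw [List.length_zip, hw, min_self]
      obtain ⟨i', u', hu1, hu2, hu3⟩ := absorb i a (u.zip e₁)
      -- Both terms on the right of `hswap` have the single letter p * q in place of p and q, with
      -- the same degree; the power of x lying before or after it joins a neighbouring exponent.
      have z1 := ih _ (by simp at h1 ⊢; omega) i' (u' ++ (p * q, b) :: w.zip e₂)
        (by simp [hdeg] at hu2 hsum ⊢; simp at h3; omega) rfl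
      have z2 := ih _ (by simp at h1 ⊢; omega) i (u.zip e₁ ++ (p * q, a + b) :: w.zip e₂)
        (by simp [hdeg] at hsum ⊢; simp at h3; omega) rfl
      rw [List.map_append, List.prod_append, ← mul_assoc, hu3] at z1
      rw [List.map_append, List.prod_append] at z2
      have hs := congrArg (fun t => x ^ i * ((u.zip e₁).map fun a => ev a.1 * x ^ a.2).prod * t
        * x ^ b * ((w.zip e₂).map fun a => ev a.1 * x ^ a.2).prod) (hswap a p q)
      simp only [List.zip_append he₁.symm, List.zip_cons_cons, List.map_append, List.map_cons,
        List.prod_append, List.prod_cons, pow_add, mul_add, add_mul, smul_mul_assoc,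
        mul_smul_comm, mul_assoc, smul_add] at z1 z2 hs ⊢
      linear_combination (norm := module) hs + c a • z1 + c a • z2

/-- Induction on the number of generators. By `hmul` the value of a monomial lies in the power of
the span given by its degree, so by induction only finitely many monomials in the first k generators
have nonzero value. Words in all generators are words in these values separated by powers of the
last generator x, where x³ = 0, and letters separated by a power of x anticommute up to shorter
words. -/
theorem exists_pow_span_eq_bot (h2 : (2 : K) ≠ 0) (h3 : (3 : K) ≠ 0) (ev : G → R)
    (hmul : ∀ a b, ev (a * b) = -(ev a * ev b + ev b * ev a))
    (hsym : ∀ a b c, ev a * ev b * ev c + ev a * ev c * ev b + ev b * ev a * ev c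
      + ev b * ev c * ev a + ev c * ev a * ev b + ev c * ev b * ev a = 0) :
    ∀ (k : ℕ) (g : Fin k → G), ∃ N, Submodule.span K (Set.range fun i => ev (g i)) ^ N = ⊥ := by
  have hmem {k : ℕ} (g : Fin k → G) (p : FreeMagma (Fin k)) :
      ev (FreeMagma.lift g p) ∈ Submodule.span K (Set.range fun i => ev (g i)) ^ p.length := by
    induction p using FreeMagma.recOnMul with
    | ih1 i =>
      change _ ∈ _ ^ 1
      rw [pow_one]
      exact Submodule.subset_span ⟨i, rfl⟩
    | ih2 p q hp hq =>
      change _ ∈ _ ^ (p.length + q.length)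
      rw [map_mul, hmul]
      refine neg_mem (add_mem ?_ ?_)
      · rw [pow_add]; exact Submodule.mul_mem_mul hp hq
      · rw [add_comm, pow_add]; exact Submodule.mul_mem_mul hq hp
  intro k
  induction k with
  | zero => exact fun g => ⟨1, by simp⟩
  | succ k ih =>
    intro g
    let g' (i : Fin k) : G := g i.castSucc
    obtain ⟨N, hN⟩ := ih g'
    let y : G := g (Fin.last k)
    let x : R := ev y
    let ev' (p : FreeMagma (Fin k)) : R := ev (FreeMagma.lift g' p)
    have hfin : {p : FreeMagma (Fin k) | p.length < N}.Finite := FreeMagma.finite_length_lt N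
    have hT (p : FreeMagma (Fin k)) (hp : p ∉ hfin.toFinset) : ev' p = 0 := by
      have hp : N ≤ p.length := by simpa using hp
      have h := hmem g' p
      obtain ⟨j, hj⟩ := Nat.exists_eq_add_of_le hp
      rw [hj, pow_add, hN, Submodule.bot_mul, Submodule.mem_bot] at h
      exact h
    have hx : x ^ 3 = 0 := by
      have h := hsym y y y
      have : ((2 : K) * 3) • x ^ 3 = 0 := by
        rw [pow_three, ← mul_assoc]
        linear_combination (norm := module) h
      exact (smul_eq_zero.1 this).resolve_left (mul_ne_zero h2 h3)
    -- For i = 0 the anticommutator is -ev(pq), while x^i ev(pq) + ev(pq) x^i is 2 ev(pq). For i =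
    -- 1, 2 the symmetrized triple product applies, with y and y * y in the middle; ev(y * y) =
    -- -2x².
    let c (i : ℕ) : K := if i = 0 then -(1 / 2) else 1
    have hsw (p q z : G) : ev p * ev z * ev q + ev q * ev z * ev p
        = ev z * ev (p * q) + ev (p * q) * ev z := by
      have h := hsym p z q
      simp only [hmul, mul_neg, neg_mul, mul_add, add_mul, ← mul_assoc]
      linear_combination (norm := module) h
    have hswap (i : ℕ) (p q : FreeMagma (Fin k)) : ev' p * x ^ i * ev' q + ev' q * x ^ i * ev' p
        = c i • (x ^ i * ev' (p * q) + ev' (p * q) * x ^ i) := by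
      match i with
      | 0 =>
        simp only [pow_zero, mul_one, one_mul, ev', map_mul, hmul, c, if_pos]
        have : -(1 / 2 : K) * 2 = -1 := by field_simp
        rw [← two_smul K, smul_smul, this]
        module
      | 1 =>
        have h := hsw (FreeMagma.lift g' p) (FreeMagma.lift g' q) y
        rw [← map_mul] at h
        rw [show c 1 = 1 from rfl, one_smul, pow_one]
        exact h
      | 2 =>
        have h := hsw (FreeMagma.lift g' p) (FreeMagma.lift g' q) (y * y)
        rw [← map_mul, hmul y y, ← two_smul K, ← sq] at h
        simp only [mul_neg, neg_mul, mul_smul_comm, smul_mul_assoc] at h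
        have : (2 : K) • (ev' p * x ^ 2 * ev' q + ev' q * x ^ 2 * ev' p
            - (x ^ 2 * ev' (p * q) + ev' (p * q) * x ^ 2)) = 0 := by
          linear_combination (norm := module) -h
        rw [show c 2 = 1 from rfl, one_smul]
        exact sub_eq_zero.1 ((smul_eq_zero.1 this).resolve_left h2)
      | i + 3 => simp [pow_add, hx]
    set B := 2 * (hfin.toFinset.card + 1) + hfin.toFinset.card * N
    have key := pow_mul_prod_eq_zero h2 FreeMagma.length (fun _ _ => rfl) ev' hfin.toFinset N hT
      (fun p hp => le_of_lt (by simpa using hp)) x hx c hswap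
    refine ⟨B + 1, ?_⟩
    -- Read from the right, a letter x raises the initial exponent, and any other generator starts a
    -- new block that takes over this exponent.
    have hword (w : List (Fin (k + 1))) : ∃ (i : ℕ) (l : List (FreeMagma (Fin k) × ℕ)),
        i + (l.map fun a => a.1.length + a.2).sum = w.length ∧
        x ^ i * (l.map fun a => ev' a.1 * x ^ a.2).prod = (w.map fun i => ev (g i)).prod := by
      induction w with
      | nil => exact ⟨0, [], rfl, by simp⟩
      | cons j w ihw =>
        obtain ⟨i, l, h1, h2⟩ := ihw
        induction j using Fin.lastCases with
        | last =>
          exact ⟨i + 1, l, by simp [← h1]; omega, by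
            rw [List.map_cons, List.prod_cons, ← h2, pow_succ', mul_assoc]⟩
        | cast j =>
          exact ⟨0, (.of j, i) :: l, by simp [← h1]; omega, by
            rw [List.map_cons, List.prod_cons, List.map_cons, List.prod_cons, ← h2, pow_zero,
              one_mul, mul_assoc]; rfl⟩
    rw [Submodule.span_pow, Submodule.span_eq_bot]
    intro r hr
    obtain ⟨f, rfl⟩ := Set.mem_pow.1 hr
    choose w hw using fun i => (f i).2
    obtain ⟨i, l, h1, h2⟩ := hword (List.ofFn w)
    have : (List.ofFn fun i => (f i : R)) = (List.ofFn w).map fun i => ev (g i) := by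
      rw [List.map_ofFn]
      exact congrArg List.ofFn (funext fun i => (hw i).symm)
    rw [this, ← h2]
    exact key i l (by rw [h1, List.length_ofFn]; omega)

end Anticommuting

/-! ### Finitely generated algebras with cube zero -/

section CubeZero

variable {K : Type u} [Field K] {A : Type v} [NonUnitalNonAssocCommRing A] [Module K A]
  [IsScalarTower K A A] [SMulCommClass K A A]

/-- Finitely generated commutative algebras satisfying `x ^ 3 = 0` are nilpotent. -/
theorem exists_productsVanish_of_cubeForm_eq_zero (h2 : (2 : K) ≠ 0) (h3 : (3 : K) ≠ 0)
    (hA : ∀ a b c : A, cubeForm a b c = 0) {k : ℕ} (g : Fin k → A)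
    (hg : Submodule.span K (Set.range (CommMonomial.lift g)) = ⊤) :
    ∃ N, 0 < N ∧ ProductsVanish A N := by
  have hmul (a b : A) : mulLeft K (a * b)
      = -(mulLeft K a * mulLeft K b + mulLeft K b * mulLeft K a) := by
    have : cubeOp K a b = 0 := LinearMap.ext fun d => by
      rw [cubeOp_apply, hA, LinearMap.zero_apply]
    rw [mulLeft_mul_eq, this]; abel
  have hsym (a b c : A) :
      mulLeft K a * mulLeft K b * mulLeft K c + mulLeft K a * mulLeft K c * mulLeft K b
        + mulLeft K b * mulLeft K a * mulLeft K c + mulLeft K b * mulLeft K c * mulLeft K a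
        + mulLeft K c * mulLeft K a * mulLeft K b + mulLeft K c * mulLeft K b * mulLeft K a
        = 0 := by
    -- Expanding L_{ {a,b,c} } = 0 twice by `hmul` gives each of the six orderings exactly two
    -- times.
    have h : mulLeft K (a * (b * c)) + mulLeft K (b * (a * c)) + mulLeft K (c * (a * b)) = 0 := by
      rw [← mulLeft_add', ← mulLeft_add', ← cubeForm, hA, mulLeft_zero']
    rw [hmul a, hmul b c, hmul b, hmul a c, hmul c, hmul a b] at h
    simp only [mul_neg, neg_mul, mul_add, add_mul, ← mul_assoc] at h
    have h' : (2 : K) • (mulLeft K a * mulLeft K b * mulLeft K c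
        + mulLeft K a * mulLeft K c * mulLeft K b + mulLeft K b * mulLeft K a * mulLeft K c
        + mulLeft K b * mulLeft K c * mulLeft K a + mulLeft K c * mulLeft K a * mulLeft K b
        + mulLeft K c * mulLeft K b * mulLeft K a) = 0 := by
      linear_combination (norm := module) h
    exact (smul_eq_zero.1 h').resolve_left h2
  obtain ⟨N, hN⟩ := exists_pow_span_eq_bot h2 h3 (mulLeft K) hmul hsym k g
  set V := Submodule.span K (Set.range fun i => mulLeft K (g i))
  -- Multiplication by a monomial of degree j lies in V^j, so V^N = 0 makes any N nested
  -- multiplications by monomials vanish.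
  have hV (p : CommMonomial (Fin k)) : mulLeft K (CommMonomial.lift g p) ∈ V ^ p.degree := by
    induction p using Con.induction_on with
    | H w =>
      change mulLeft K (FreeMagma.lift g w) ∈ V ^ w.length
      induction w using FreeMagma.recOnMul with
      | ih1 i =>
        change _ ∈ _ ^ 1
        rw [pow_one]
        exact Submodule.subset_span ⟨i, rfl⟩
      | ih2 p q hp hq =>
        change _ ∈ _ ^ (p.length + q.length)
        rw [map_mul, hmul]
        refine neg_mem (add_mem ?_ ?_)
        · rw [pow_add]; exact Submodule.mul_mem_mul hp hq
        · rw [add_comm, pow_add]; exact Submodule.mul_mem_mul hq hp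
  refine ⟨2 ^ N, by positivity, productsVanish_two_pow (m := N) ?_ le_rfl⟩
  refine foldr_mul_eq_zero_of_span _ hg N fun l p hl => ?_
  have hfold (l : List (CommMonomial (Fin k))) (b : A) :
      ∃ φ ∈ V ^ (l.map CommMonomial.degree).sum,
        l.foldr (fun p c => CommMonomial.lift g p * c) b = φ b := by
    induction l with
    | nil => exact ⟨1, Submodule.one_le.1 le_rfl, rfl⟩
    | cons q l ih =>
      obtain ⟨φ, h1, h2⟩ := ih
      refine ⟨mulLeft K (CommMonomial.lift g q) * φ, ?_, by rw [List.foldr_cons, h2]; rfl⟩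
      rw [List.map_cons, List.sum_cons, pow_add]
      exact Submodule.mul_mem_mul (hV q) h1
  obtain ⟨φ, h1, h2⟩ := hfold l (CommMonomial.lift g p)
  have hle : N ≤ (l.map CommMonomial.degree).sum := by
    have : (l.map CommMonomial.degree).length ≤ (l.map CommMonomial.degree).sum :=
      List.length_le_sum_of_one_le _ fun i hi => by
        obtain ⟨p, -, rfl⟩ := List.mem_map.1 hi
        exact p.degree_pos
    rwa [List.length_map, hl] at this
  obtain ⟨j, hj⟩ := Nat.exists_eq_add_of_le hle
  rw [hj, pow_add, hN, Submodule.bot_mul, Submodule.mem_bot] at h1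
  rw [h2, h1, LinearMap.zero_apply]

end CubeZero

/-! ### Nilpotency of the free algebra with cube zero -/

section FreeCubeZero

variable {X : Type v} {K : Type u} [Field K]

namespace FreeCubeZeroAlg

instance : IsScalarTower K (FreeCubeZeroAlg K X) (FreeCubeZeroAlg K X) where
  smul_assoc := by
    rintro t ⟨a⟩ ⟨b⟩
    exact congrArg (Submodule.Quotient.mk (p := cubeIdeal K X)) (smul_mul_assoc t a b)

instance : SMulCommClass K (FreeCubeZeroAlg K X) (FreeCubeZeroAlg K X) where
  smul_comm := by
    rintro t ⟨a⟩ ⟨b⟩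
    exact congrArg (Submodule.Quotient.mk (p := cubeIdeal K X)) (mul_smul_comm t a b).symm

theorem cubeForm_eq_zero (h2 : (2 : K) ≠ 0) (a b c : FreeCubeZeroAlg K X) :
    cubeForm a b c = 0 := by
  have h := cubeForm_mem_cubeSpan h2 a b c
  have h' : cubeSpan K (FreeCubeZeroAlg K X) = ⊥ := by
    rw [cubeSpan, Submodule.span_eq_bot]
    rintro _ ⟨⟨a⟩, rfl⟩
    exact (Submodule.Quotient.mk_eq_zero _).2 (cube_mem_cubeIdeal a)
  rwa [h', Submodule.mem_bot] at h

theorem span_range_lift_gen :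
    Submodule.span K (Set.range (CommMonomial.lift (gen K) : CommMonomial X →ₙ* _)) = ⊤ := by
  rw [eq_top_iff]
  rintro ⟨f⟩ -
  change Submodule.Quotient.mk f ∈ _
  induction f using MonoidAlgebra.induction_linear with
  | zero => exact zero_mem _
  | add f g hf hg => exact add_mem hf hg
  | single p r =>
    have h : (MonoidAlgebra.single p r : FreeCommAlg K X) = r • MonoidAlgebra.single p 1 := by
      rw [MonoidAlgebra.smul_single, smul_eq_mul, mul_one]
    rw [h, Submodule.Quotient.mk_smul]
    refine Submodule.smul_mem _ _ (Submodule.subset_span ⟨p, ?_⟩)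
    induction p using Con.induction_on with
    | H w => exact lift_gen w

theorem exists_productsVanish (h2 : (2 : K) ≠ 0) (h3 : (3 : K) ≠ 0) (k : ℕ) :
    ∃ N, 0 < N ∧ ProductsVanish (FreeCubeZeroAlg K (Fin k)) N :=
  exists_productsVanish_of_cubeForm_eq_zero h2 h3 (cubeForm_eq_zero h2) (gen K)
    span_range_lift_gen

end FreeCubeZeroAlg

end FreeCubeZero

/-! ### Local nilpotency and the conclusion -/

section LocallyNilpotent

variable {K : Type u} [Field K] {A : Type v} [NonUnitalNonAssocCommRing A] [Module K A]
  [IsScalarTower K A A] [SMulCommClass K A A] {γ : K}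

theorem SatisfiesCubicIdentity.subalgebra (hA : SatisfiesCubicIdentity K A γ)
    (S : NonUnitalSubalgebra K A) : SatisfiesCubicIdentity K S γ := fun x =>
  LinearMap.ext fun v => Subtype.ext (hA.apply (x : A) v)

/-- The superfluous generator 0 keeps the number of generators positive even when s is empty, as the
bound requires k ≥ 1. -/
theorem isGeneratedBy_adjoin (s : Finset A) :
    IsGeneratedBy K (NonUnitalAlgebra.adjoin K (s : Set A)) (s.card + 1) := by
  let e := s.equivFin
  let g (i : Fin (s.card + 1)) : NonUnitalAlgebra.adjoin K (s : Set A) :=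
    Fin.lastCases 0 (fun j => ⟨e.symm j, NonUnitalAlgebra.subset_adjoin K (e.symm j).2⟩) i
  refine ⟨g, ?_⟩
  rw [eq_top_iff]
  rintro ⟨a, ha⟩ -
  induction ha using NonUnitalAlgebra.adjoin_induction with
  | mem x hx =>
    refine NonUnitalAlgebra.subset_adjoin K ⟨(e ⟨x, hx⟩).castSucc, ?_⟩
    simp [g]
  | add x y _ _ hx hy => exact add_mem hx hy
  | zero => exact zero_mem _
  | mul x y _ _ hx hy => exact mul_mem hx hy
  | smul r x _ hx => exact SMulMemClass.smul_mem r hx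

end LocallyNilpotent

theorem theorem3 {K : Type u} [Field K] (h2 : ringChar K ≠ 2) (h3 : ringChar K ≠ 3)
    (γ : K) (hγ0 : γ ≠ 0) (hγ1 : γ ≠ 1) (hγ1' : γ ≠ -1)
    (hγ2 : γ ≠ 1 / 2) (hγ2' : γ ≠ -(1 / 2)) :
    (∀ (A : Type v) [NonUnitalNonAssocCommRing A] [Module K A] [IsScalarTower K A A]
        [SMulCommClass K A A],
      SatisfiesCubicIdentity K A γ → IsLocallyNilpotentAlgebra K A) ∧
    (∀ k : ℕ, 1 ≤ k →
      ∃ n : ℕ, HasNilpotencyIndex (FreeCubeZeroAlg K (Fin k)) n ∧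
        ∀ (A : Type v) [NonUnitalNonAssocCommRing A] [Module K A] [IsScalarTower K A A]
          [SMulCommClass K A A],
          SatisfiesCubicIdentity K A γ → IsGeneratedBy K A k →
            ∃ m : ℕ, HasNilpotencyIndex A m ∧
              m ≤ 2 ^ (4 * n * dimBelow K n k + 2 * (n - 2))) := by
  have h2' : (2 : K) ≠ 0 := Ring.two_ne_zero h2
  have h3' : (3 : K) ≠ 0 := by
    intro h
    have hd : ringChar K ∣ 3 := ringChar.dvd (by exact_mod_cast h)
    rcases (Nat.dvd_prime Nat.prime_three).1 hd with h1 | h1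
    · have := ringChar.Nat.cast_ringChar (R := K)
      rw [h1, Nat.cast_one] at this
      exact one_ne_zero this
    · exact h3 h1
  have hb (k : ℕ) (hk : 1 ≤ k) :
      ∃ n : ℕ, HasNilpotencyIndex (FreeCubeZeroAlg K (Fin k)) n ∧
        ∀ (A : Type v) [NonUnitalNonAssocCommRing A] [Module K A] [IsScalarTower K A A]
          [SMulCommClass K A A],
          SatisfiesCubicIdentity K A γ → IsGeneratedBy K A k →
            ∃ m : ℕ, HasNilpotencyIndex A m ∧
              m ≤ 2 ^ (4 * n * dimBelow K n k + 2 * (n - 2)) := by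
    obtain ⟨N, hN, hv⟩ := FreeCubeZeroAlg.exists_productsVanish h2' h3' k
    obtain ⟨n, hn, -⟩ := exists_hasNilpotencyIndex_le hN hv
    exact ⟨n, hn, fun A _ _ _ _ hA hg =>
      hA.exists_hasNilpotencyIndex_le h2' h3' hγ1' hγ0 hγ2 hγ2' hk hn hg⟩
  refine ⟨fun A _ _ _ _ hA s => ?_, hb⟩
  -- Local nilpotency follows from the bound, since the identity is inherited by the subalgebra
  -- generated by s.
  obtain ⟨n, -, h⟩ := hb (s.card + 1) (Nat.le_add_left 1 _)
  obtain ⟨m, hm, -⟩ := h _ (hA.subalgebra (NonUnitalAlgebra.adjoin K (s : Set A)))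
    (isGeneratedBy_adjoin s)
  exact ⟨m, hm.1⟩
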